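/- Let $\alpha>-1$ and let $k\ge 1$ be an integer. For $t,x,y>0$ let $$W_t^\alpha(x,y)=\Big(\frac{2e^{-t}}{1-e^{-2t}}\Big)^{1/2}\Big(\frac{2xye^{-t}}{1-e^{-2t}}\Big)^{1/2} I_\alpha\Big(\frac{2xye^{-t}}{1-e^{-2t}}\Big)\,e^{-\frac12(x^2+y^2)\frac{1+e^{-2t}}{1-e^{-2t}}}$$ be the heat kernel of the Laguerre operator $L_\alpha=\frac12\big(-\frac{d^2}{dx^2}+x^2+\frac{1}{x^2}(\alpha^2-\frac14)\big)$ on $(0,\infty)$, where $I_\alpha(z)=\sum_{m\ge 0}\frac{(z/2)^{2m+\alpha}}{m!\,\Gamma(m+\alpha+1)}$ is the modified Bessel function of the first kind, and, for $t>0$ and $x,y\in\mathbb R$, let $$W_t(x,y)=\frac{1}{\sqrt\pi}\Big(\frac{e^{-t}}{1-e^{-2t}}\Big)^{1/2}e^{-\frac12(x^2+y^2)\frac{1+e^{-2t}}{1-e^{-2t}}+\frac{2xye^{-t}}{1-e^{-2t}}}$$ be the heat kernel of the Hermite operator $\frac12\big(-\frac{d^2}{dx^2}+x^2\big)$ on $\mathbb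 R$. Put $\mathfrak D_\alpha=-\frac{\alpha+1/2}{x}+x+\frac{d}{dx}$ and define the Laguerre and Hermite Riesz kernels, for $x,y>0$ with $x\neq y$, by $$R_\alpha^{(k)}(x,y)=\frac{1}{\Gamma(k/2)}\int_0^\infty t^{\frac k2-1}\,\mathfrak D_\alpha^k W_t^\alpha(x,y)\,dt,\qquad R^{(k)}(x,y)=\frac{1}{\Gamma(k/2)}\int_0^\infty t^{\frac k2-1}\Big(\frac{d}{dx}+x\Big)^k W_t(x,y)\,dt,$$ where the differential operators act in the variable $x$. Then both integrals converge absolutely for all $x,y>0$ with $x\ne y$, and there is a constant $C>0$, depending only on $\alpha$ and $k$, such that: (i) $|R_\alpha^{(k)}(x,y)|\le C\,\dfrac{y^{\alpha+1/2}}{x^{\alpha+3/2}}$ whenever $0<y<x/2$; (ii) for all $x>0$ and $y>2x$: $|R_\alpha^{(k)}(x,y)|\le C\,\dfrac{x^{\alpha+1/2}}{y^{\alpha+3/2}}$ if $k$ is even, and $|R_\alpha^{(k)}(x,y)|\le C\,\dfrac{x^{\alpha+3/2}}{y^{\alpha+5/2}}$ if $k$ is odd; (iii) $|R_\alpha^{(k)}(x,y)-R^{(k)}(x,y)|\le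 \dfrac{C}{x}\Big(1+\Big(\dfrac{x}{|x-y|}\Big)^{1/2}\Big)$ whenever $x>0$, $x/2<y<2x$ and $y\ne x$. -/

import Mathlib

noncomputable section

/-- The modified Bessel function of the first kind and order `ν`, for `z > 0`:
`I_ν(z) = ∑ₘ (z/2)^(2m+ν) / (m! Γ(m+ν+1))`. -/
def besselI (ν z : ℝ) : ℝ :=
  ∑' m : ℕ, (z / 2) ^ (2 * (m : ℝ) + ν) / ((m.factorial : ℝ) * Real.Gamma ((m : ℝ) + ν + 1))

/-- The heat kernel `W_t^α(x,y)`, `t, x, y > 0`, of the Laguerre operator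
`L_α = (1/2)(-d²/dx² + x² + x⁻²(α² - 1/4))` on `(0,∞)`. -/
def laguerreHeat (α t x y : ℝ) : ℝ :=
  (2 * Real.exp (-t) / (1 - Real.exp (-2 * t))) ^ (1 / 2 : ℝ) *
    (2 * x * y * Real.exp (-t) / (1 - Real.exp (-2 * t))) ^ (1 / 2 : ℝ) *
    besselI α (2 * x * y * Real.exp (-t) / (1 - Real.exp (-2 * t))) *
    Real.exp (-(1 / 2) * (x ^ 2 + y ^ 2) *
      ((1 + Real.exp (-2 * t)) / (1 - Real.exp (-2 * t))))

/-- The heat kernel `W_t(x,y)`, `t > 0`, of the Hermite operator `H = (1/2)(-d²/dx² + x²)`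
on the real line. -/
def hermiteHeat (t x y : ℝ) : ℝ :=
  1 / Real.sqrt Real.pi * (Real.exp (-t) / (1 - Real.exp (-2 * t))) ^ (1 / 2 : ℝ) *
    Real.exp (-(1 / 2) * (x ^ 2 + y ^ 2) *
        ((1 + Real.exp (-2 * t)) / (1 - Real.exp (-2 * t))) +
      2 * x * y * Real.exp (-t) / (1 - Real.exp (-2 * t)))

/-- The first order operator `𝔇_α f = (-(α + 1/2)/x + x + d/dx) f`, used at points `x > 0`. -/
def laguerreD (α : ℝ) (f : ℝ → ℝ) : ℝ → ℝ :=
  fun x => (-(α + 1 / 2) / x + x) * f x + deriv f x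

/-- The first order operator `(d/dx + x) f`. -/
def hermiteD (f : ℝ → ℝ) : ℝ → ℝ :=
  fun x => deriv f x + x * f x

/-- The function `t ↦ t^(k/2 - 1) 𝔇_α^k W_t^α(x,y)`, the operator acting in the variable `x`. -/
def laguerreRieszIntegrand (α : ℝ) (k : ℕ) (x y t : ℝ) : ℝ :=
  t ^ ((k : ℝ) / 2 - 1) * (laguerreD α)^[k] (fun u => laguerreHeat α t u y) x

/-- The function `t ↦ t^(k/2 - 1) (d/dx + x)^k W_t(x,y)`, the operator acting in the
variable `x`. -/
def hermiteRieszIntegrand (k : ℕ) (x y t : ℝ) : ℝ :=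
  t ^ ((k : ℝ) / 2 - 1) * hermiteD^[k] (fun u => hermiteHeat t u y) x

/-- The kernel `R_α^{(k)}(x,y)` of the `k`-th Riesz transform in the Laguerre setting. -/
def laguerreRieszKernel (α : ℝ) (k : ℕ) (x y : ℝ) : ℝ :=
  1 / Real.Gamma ((k : ℝ) / 2) * ∫ t in Set.Ioi (0 : ℝ), laguerreRieszIntegrand α k x y t

/-- The kernel `R^{(k)}(x,y)` of the `k`-th Riesz transform in the Hermite setting. -/
def hermiteRieszKernel (k : ℕ) (x y : ℝ) : ℝ :=
  1 / Real.Gamma ((k : ℝ) / 2) * ∫ t in Set.Ioi (0 : ℝ), hermiteRieszIntegrand k x y t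

end

open Set Filter Topology MeasureTheory
open scoped ContDiff

/-! Write I_α(z) = z^α e^z Φ(z). Then Φ is smooth, its j-th derivative is O((1+z)^(-α-1/2-j)) on
[0,∞), and z^(α+1/2) Φ(z) = 1/√(2π) + O(1/z). Poisson's integral gives this for α > 3/2, and I_α =
I_(α+2) + 2(α+1) I_(α+1)/z carries it down to α > -1 (`exists_isBesselSymbol`).

Put σ = 1/sinh t, b = yσ, a = e^(-t)σ/2, z = xyσ. The weight x^(α+1/2) e^(-x²/2) conjugates 𝔇_α to
d/dx, so 𝔇_α^k W_t^α is an explicit factor times the k-th x-derivative of Φ(bx) e^(bx-ax²). The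
Hermite kernel is the same expression with α = -1/2 and Φ = 1/√(2π). Leibniz's rule and Hermite
polynomials bound the derivative at the cost of part of the Gaussian; what remains yields
exp(-(x-y)²/(4t)) (`mehlerWeight_mul_exp_le`).

Off the diagonal (x-y)² is comparable to x²+y², this exponential absorbs all polynomial factors, and
the t-integral is a Gamma integral of size (xy)^(α+1/2) (x²+y²)^(-α-1): this is (i) and the even
case of (ii). For odd k the differentiated function is even in x, so its k-th derivative vanishes at
0 and the mean value theorem gains x/y.

Near the diagonal the integral is cut at sinh t = xy. Beyond the cut z ≤ 1 and each kernel
separately contributes O(1/x). Before it z ≥ 1; a derivative falling on Φ, or replacing z^(α+1/2) Φ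
by its limit, gains enough to bound the difference of the integrands by x⁻¹ t⁻¹ exp(-(x-y)²/(4t))
(`abs_rieszIntegrand_sub_hermite_le`). -/

/-! ### Symbol classes on the half-line. -/

/-- `f` is smooth and its `j`-th derivative is `O((1 + z)^(ρ - j))` on `[0, ∞)`. -/
def IsSymbol (ρ : ℝ) (f : ℝ → ℝ) : Prop :=
  ContDiff ℝ ∞ f ∧ ∀ j : ℕ, ∃ C : ℝ, 0 ≤ C ∧ ∀ z : ℝ, 0 ≤ z →
    |iteratedDeriv j f z| ≤ C * (1 + z) ^ (ρ - j)

namespace IsSymbol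

variable {ρ ρ' : ℝ} {f g : ℝ → ℝ}

theorem mono (hf : IsSymbol ρ f) (h : ρ ≤ ρ') : IsSymbol ρ' f := by
  refine ⟨hf.1, fun j => ?_⟩
  obtain ⟨C, hC, hb⟩ := hf.2 j
  refine ⟨C, hC, fun z hz => (hb z hz).trans ?_⟩
  gcongr
  linarith

theorem add (hf : IsSymbol ρ f) (hg : IsSymbol ρ g) : IsSymbol ρ (f + g) := by
  refine ⟨hf.1.add hg.1, fun j => ?_⟩
  obtain ⟨C, hC, hb⟩ := hf.2 j
  obtain ⟨C', hC', hb'⟩ := hg.2 j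
  refine ⟨C + C', by positivity, fun z hz => ?_⟩
  rw [iteratedDeriv_add (hf.1.contDiffAt.of_le (by exact_mod_cast le_top))
    (hg.1.contDiffAt.of_le (by exact_mod_cast le_top)), add_mul]
  exact (abs_add_le _ _).trans (add_le_add (hb z hz) (hb' z hz))

theorem const_mul (hf : IsSymbol ρ f) (c : ℝ) : IsSymbol ρ (fun z => c * f z) := by
  refine ⟨contDiff_const.mul hf.1, fun j => ?_⟩
  obtain ⟨C, hC, hb⟩ := hf.2 j
  refine ⟨|c| * C, by positivity, fun z hz => ?_⟩
  rw [iteratedDeriv_const_mul_field, abs_mul, mul_assoc]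
  exact mul_le_mul_of_nonneg_left (hb z hz) (abs_nonneg c)

/-- The truncated subtraction `j - 1` is harmless at `j = 0`, where its term carries the factor `j`.
-/
theorem _root_.iteratedDeriv_id_mul (hf : ContDiff ℝ ∞ f) (j : ℕ) (z : ℝ) :
    iteratedDeriv j (fun z => z * f z) z =
      z * iteratedDeriv j f z + j * iteratedDeriv (j - 1) f z := by
  have hd : ∀ n : ℕ, Differentiable ℝ (iteratedDeriv n f) := fun n =>
    hf.differentiable_iteratedDeriv n (by exact_mod_cast WithTop.coe_lt_top n)
  induction j generalizing z with
  | zero => simp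
  | succ j ih =>
    rw [iteratedDeriv_succ, funext ih]
    have h1 : HasDerivAt (fun z => z * iteratedDeriv j f z)
        (1 * iteratedDeriv j f z + z * iteratedDeriv (j + 1) f z) z := by
      rw [iteratedDeriv_succ]
      exact (hasDerivAt_id z).mul (hd j z).hasDerivAt
    have h2 : HasDerivAt (fun z => (j : ℝ) * iteratedDeriv (j - 1) f z)
        (j * iteratedDeriv j f z) z := by
      rcases j with _ | j
      · simpa using hasDerivAt_const z (0 : ℝ)
      · have := ((hd j z).hasDerivAt).const_mul ((j + 1 : ℕ) : ℝ)
        rw [← iteratedDeriv_succ] at this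
        simpa using this
    refine (h1.add h2).deriv.trans ?_
    push_cast [Nat.add_sub_cancel]
    ring

theorem id_mul (hf : IsSymbol ρ f) : IsSymbol (ρ + 1) (fun z => z * f z) := by
  refine ⟨contDiff_id.mul hf.1, fun j => ?_⟩
  obtain ⟨C, hC, hb⟩ := hf.2 j
  obtain ⟨C', hC', hb'⟩ := hf.2 (j - 1)
  refine ⟨C + j * C', by positivity, fun z hz => ?_⟩
  have h1 : (0 : ℝ) < 1 + z := by linarith
  rw [iteratedDeriv_id_mul hf.1]
  have e1 : |z * iteratedDeriv j f z| ≤ C * (1 + z) ^ (ρ + 1 - j) := by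
    rw [abs_mul, abs_of_nonneg hz]
    calc z * |iteratedDeriv j f z| ≤ (1 + z) * (C * (1 + z) ^ (ρ - j)) := by
          gcongr
          · linarith
          · exact hb z hz
      _ = C * (1 + z) ^ (ρ + 1 - j) := by
          rw [show ρ + 1 - j = (ρ - j) + 1 by ring, Real.rpow_add_one h1.ne']
          ring
  have e2 : |(j : ℝ) * iteratedDeriv (j - 1) f z| ≤ j * C' * (1 + z) ^ (ρ + 1 - j) := by
    rcases j with _ | j
    · simp
    · rw [abs_mul, abs_of_nonneg (by positivity : (0 : ℝ) ≤ ((j + 1 : ℕ) : ℝ)), mul_assoc]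
      gcongr
      have := hb' z hz
      simp only [Nat.add_sub_cancel] at this ⊢
      refine this.trans_eq ?_
      push_cast
      ring_nf
  calc _ ≤ _ := abs_add_le _ _
    _ ≤ _ := add_le_add e1 e2
    _ = _ := by ring

end IsSymbol

/-! ### Laplace transform of the Poisson weight: symbol bounds and asymptotics. -/

/-- The `j`-th derivative of the Laplace transform of the weight `(u (2 - u))^β` on `[0, 2]`. -/
noncomputable def laplaceWeight (β : ℝ) (j : ℕ) (z : ℝ) : ℝ :=
  ∫ u in (0 : ℝ)..2, (-u) ^ j * Real.exp (-(z * u)) * (u * (2 - u)) ^ β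

theorem hasDerivAt_laplaceWeight {β : ℝ} (hβ : 0 ≤ β) (j : ℕ) (z : ℝ) :
    HasDerivAt (laplaceWeight β j) (laplaceWeight β (j + 1) z) z := by
  have hc : ∀ (j : ℕ) (z : ℝ), Continuous
      (fun u : ℝ => (-u) ^ j * Real.exp (-(z * u)) * (u * (2 - u)) ^ β) := fun j z =>
    (by fun_prop : Continuous fun u : ℝ => (-u) ^ j * Real.exp (-(z * u))).mul
      ((by fun_prop : Continuous fun u : ℝ => u * (2 - u)).rpow_const fun _ => Or.inr hβ)
  refine (intervalIntegral.hasDerivAt_integral_of_dominated_loc_of_deriv_le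
    (F := fun z u => (-u) ^ j * Real.exp (-(z * u)) * (u * (2 - u)) ^ β)
    (F' := fun z u => (-u) ^ (j + 1) * Real.exp (-(z * u)) * (u * (2 - u)) ^ β)
    (s := Metric.ball z 1)
    (bound := fun u => |(-u) ^ (j + 1)| * Real.exp ((|z| + 1) * |u|) * |(u * (2 - u)) ^ β|)
    (Metric.ball_mem_nhds z one_pos) ?_ ?_ ?_ ?_ ?_ ?_).2
  · exact Eventually.of_forall fun x => (hc j x).aestronglyMeasurable
  · exact (hc j z).intervalIntegrable _ _
  · exact (hc (j + 1) z).aestronglyMeasurable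
  · refine Eventually.of_forall fun u _ x hx => ?_
    rw [Real.norm_eq_abs, abs_mul, abs_mul, Real.abs_exp]
    gcongr
    have h1 : |x| ≤ |z| + 1 := by
      rw [Metric.mem_ball, Real.dist_eq] at hx
      have := abs_sub_abs_le_abs_sub x z
      linarith
    calc -(x * u) ≤ |x * u| := neg_le_abs _
      _ = |x| * |u| := abs_mul _ _
      _ ≤ _ := by gcongr
  · refine Continuous.intervalIntegrable ?_ _ _
    exact (by fun_prop : Continuous fun u : ℝ => |(-u) ^ (j + 1)| * Real.exp ((|z| + 1) * |u|)).mul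
      ((by fun_prop : Continuous fun u : ℝ => u * (2 - u)).rpow_const fun _ => Or.inr hβ).abs
  · refine Eventually.of_forall fun u _ x _ => ?_
    have h : HasDerivAt (fun x : ℝ => -(x * u)) (-u) x := by
      convert! ((hasDerivAt_id x).mul_const u).neg using 1
      simp
    convert! (h.exp.const_mul ((-u) ^ j)).mul_const ((u * (2 - u)) ^ β) using 1
    ring

theorem iteratedDeriv_laplaceWeight {β : ℝ} (hβ : 0 ≤ β) (j : ℕ) :
    iteratedDeriv j (laplaceWeight β 0) = laplaceWeight β j := by
  induction j with
  | zero => simp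
  | succ j ih =>
    rw [iteratedDeriv_succ, ih]
    exact funext fun z => (hasDerivAt_laplaceWeight hβ j z).deriv

theorem contDiff_laplaceWeight {β : ℝ} (hβ : 0 ≤ β) : ContDiff ℝ ∞ (laplaceWeight β 0) := by
  refine contDiff_of_differentiable_iteratedDeriv fun m _ => ?_
  rw [iteratedDeriv_laplaceWeight hβ]
  exact fun z => (hasDerivAt_laplaceWeight hβ m z).differentiableAt

theorem integrableOn_rpow_mul_exp_neg_mul {a r : ℝ} (ha : -1 < a) (hr : 0 < r) :
    IntegrableOn (fun u : ℝ => u ^ a * Real.exp (-(r * u))) (Ioi 0) := by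
  have := integrableOn_rpow_mul_exp_neg_mul_rpow (s := a) (p := 1) (b := r) ha zero_lt_one hr
  simpa using this

theorem integral_rpow_mul_exp_neg_mul {a r : ℝ} (ha : -1 < a) (hr : 0 < r) :
    ∫ u in Ioi (0 : ℝ), u ^ a * Real.exp (-(r * u)) = Real.Gamma (a + 1) * r ^ (-(a + 1)) := by
  have := Real.integral_rpow_mul_exp_neg_mul_Ioi (a := a + 1) (r := r) (by linarith) hr
  rw [add_sub_cancel_right] at this
  rw [this, one_div, Real.inv_rpow hr.le, Real.rpow_neg hr.le, mul_comm]

/-- Since u ≤ 2, e^(-zu) ≤ e² e^(-(1+z)u). This replaces z by 1+z, so the Gamma integral over the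
half-line gives a bound that stays finite at z = 0. -/
theorem isSymbol_laplaceWeight {β : ℝ} (hβ : 0 ≤ β) :
    IsSymbol (-(β + 1)) (laplaceWeight β 0) := by
  refine ⟨contDiff_laplaceWeight hβ, fun j => ?_⟩
  have hG : 0 < Real.Gamma (j + β + 1) := Real.Gamma_pos_of_pos (by positivity)
  refine ⟨Real.exp 2 * 2 ^ β * Real.Gamma (j + β + 1), by positivity, fun z hz => ?_⟩
  rw [iteratedDeriv_laplaceWeight hβ, laplaceWeight,
    intervalIntegral.integral_of_le (by norm_num), ← Real.norm_eq_abs]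
  have hint := integrableOn_rpow_mul_exp_neg_mul (a := j + β) (r := 1 + z)
    (by have : (0 : ℝ) ≤ j := by positivity
        linarith) (by linarith)
  calc _ ≤ ∫ u in Ioc (0 : ℝ) 2, Real.exp 2 * 2 ^ β *
        (u ^ (j + β) * Real.exp (-((1 + z) * u))) := by
        refine norm_integral_le_of_norm_le
          ((hint.mono_set Ioc_subset_Ioi_self).const_mul _) ?_
        refine (ae_restrict_iff' measurableSet_Ioc).2 (Eventually.of_forall fun u hu => ?_)
        have hu0 : 0 < u := hu.1
        have hu2 : 0 ≤ 2 - u := by linarith [hu.2]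
        rw [Real.norm_eq_abs, abs_mul, abs_mul, Real.abs_exp, abs_pow, abs_neg,
          abs_of_pos hu0, abs_of_nonneg (by positivity), Real.mul_rpow hu0.le hu2,
          Real.rpow_add hu0, Real.rpow_natCast]
        have h1 : Real.exp (-(z * u)) ≤ Real.exp 2 * Real.exp (-((1 + z) * u)) := by
          rw [← Real.exp_add]
          exact Real.exp_le_exp.2 (by nlinarith [hu.2])
        have h2 : (2 - u) ^ β ≤ 2 ^ β := by
          gcongr
          linarith
        calc u ^ j * Real.exp (-(z * u)) * (u ^ β * (2 - u) ^ β)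
            ≤ u ^ j * (Real.exp 2 * Real.exp (-((1 + z) * u))) * (u ^ β * 2 ^ β) := by gcongr
          _ = _ := by ring
    _ = Real.exp 2 * 2 ^ β * ∫ u in Ioc (0 : ℝ) 2, (u ^ (j + β) * Real.exp (-((1 + z) * u))) :=
        integral_const_mul _ _
    _ ≤ Real.exp 2 * 2 ^ β * ∫ u in Ioi (0 : ℝ), (u ^ (j + β) * Real.exp (-((1 + z) * u))) := by
        refine mul_le_mul_of_nonneg_left ?_ (by positivity)
        refine setIntegral_mono_set hint ?_ (show Ioc (0 : ℝ) 2 ⊆ Ioi 0 from fun u hu => hu.1).eventuallyLE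
        refine (ae_restrict_iff' measurableSet_Ioi).2 (Eventually.of_forall fun u hu => ?_)
        have hu0 : (0 : ℝ) < u := hu
        simp only [Pi.zero_apply]
        positivity
    _ = _ := by
        rw [integral_rpow_mul_exp_neg_mul (by have : (0 : ℝ) ≤ j := by positivity
                                              linarith) (by linarith)]
        rw [show -(β + 1) - (j : ℝ) = -(j + β + 1) by ring]
        ring

/-- Bernoulli's inequality, the reason for β ≥ 1. The truncation at zero lets the integral over
[0,2] be compared with one over the whole half-line. -/
theorem abs_max_rpow_sub_le {β u : ℝ} (hβ : 1 ≤ β) (hu : 0 ≤ u) :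
    |max (2 - u) 0 ^ β - 2 ^ β| ≤ β * 2 ^ (β - 1) * u := by
  have h2 : (2 : ℝ) ^ β = 2 ^ (β - 1) * 2 := by
    rw [← Real.rpow_add_one (by norm_num)]; ring_nf
  have hp : (0 : ℝ) < 2 ^ (β - 1) := by positivity
  have hle : max (2 - u) 0 ^ β ≤ 2 ^ β := by
    gcongr
    simp; linarith
  rw [abs_of_nonpos (by linarith)]
  have hB := one_add_mul_self_le_rpow_one_add (s := -(min u 2) / 2) (p := β)
    (by have := min_le_right u 2
        linarith) hβ
  have hm : max (2 - u) 0 = 2 * (1 + -(min u 2) / 2) := by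
    rcases le_total u 2 with h | h
    · rw [min_eq_left h, max_eq_left (by linarith)]; ring
    · rw [min_eq_right h, max_eq_right (by linarith)]; ring
  have hnn : 0 ≤ 1 + -(min u 2) / 2 := by
    have := min_le_right u 2
    linarith
  rw [hm, Real.mul_rpow (by norm_num) hnn, h2]
  have := min_le_left u 2
  have h3 : 2 ^ (β - 1) * 2 * (1 + β * (-(min u 2) / 2)) ≤
      2 ^ (β - 1) * 2 * (1 + -(min u 2) / 2) ^ β := by gcongr
  have h4 : β * 2 ^ (β - 1) * min u 2 ≤ β * 2 ^ (β - 1) * u := by gcongr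
  nlinarith

/-- First term of Watson's lemma: near u = 0 the weight is 2^β u^β up to O(u^(β+1)), and both powers
integrate exactly against e^(-zu). -/
theorem abs_laplaceWeight_sub_le {β : ℝ} (hβ : 1 ≤ β) {z : ℝ} (hz : 0 < z) :
    |laplaceWeight β 0 z - 2 ^ β * Real.Gamma (β + 1) * z ^ (-(β + 1))| ≤
      β * 2 ^ (β - 1) * Real.Gamma (β + 2) * z ^ (-(β + 2)) := by
  have hmain := integrableOn_rpow_mul_exp_neg_mul (a := β) (r := z) (by linarith) hz
  have hnext := integrableOn_rpow_mul_exp_neg_mul (a := β + 1) (r := z) (by linarith) hz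
  have hcont : Continuous fun u : ℝ => max (2 - u) 0 ^ β :=
    (by fun_prop : Continuous fun u : ℝ => max (2 - u) 0).rpow_const fun _ => Or.inr (by linarith)
  have hbd : ∀ u ∈ Ioi (0 : ℝ), ‖u ^ β * Real.exp (-(z * u)) * (max (2 - u) 0 ^ β - 2 ^ β)‖ ≤
      β * 2 ^ (β - 1) * (u ^ (β + 1) * Real.exp (-(z * u))) := by
    intro u hu
    have hu0 : (0 : ℝ) < u := hu
    rw [norm_mul, Real.norm_eq_abs, Real.norm_eq_abs, abs_of_nonneg (by positivity),
      Real.rpow_add_one hu0.ne']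
    calc _ ≤ u ^ β * Real.exp (-(z * u)) * (β * 2 ^ (β - 1) * u) := by
          gcongr
          exact abs_max_rpow_sub_le hβ hu0.le
      _ = _ := by ring
  have hae := (ae_restrict_iff' (μ := volume) measurableSet_Ioi).2 (Eventually.of_forall hbd)
  have hdiff : IntegrableOn
      (fun u => u ^ β * Real.exp (-(z * u)) * (max (2 - u) 0 ^ β - 2 ^ β)) (Ioi 0) := by
    refine Integrable.mono' (hnext.const_mul (β * 2 ^ (β - 1))) ?_ hae
    exact hmain.aestronglyMeasurable.mul (hcont.sub continuous_const).aestronglyMeasurable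
  have hw : laplaceWeight β 0 z =
      ∫ u in Ioi (0 : ℝ), u ^ β * Real.exp (-(z * u)) * max (2 - u) 0 ^ β := by
    rw [laplaceWeight, intervalIntegral.integral_of_le (by norm_num)]
    symm
    rw [setIntegral_eq_of_subset_of_forall_sdiff_eq_zero measurableSet_Ioi
      (show Ioc (0 : ℝ) 2 ⊆ Ioi 0 from fun u hu => hu.1)]
    · refine setIntegral_congr_fun measurableSet_Ioc fun u hu => ?_
      have h2 : 0 ≤ 2 - u := by linarith [hu.2]
      simp only [pow_zero, one_mul]
      rw [max_eq_left h2, Real.mul_rpow hu.1.le h2]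
      ring
    · intro u hu
      have : 2 - u ≤ 0 := by
        by_contra! h
        exact hu.2 ⟨hu.1, by linarith⟩
      rw [max_eq_right this, Real.zero_rpow (by linarith), mul_zero]
  have hsplit : laplaceWeight β 0 z - 2 ^ β * Real.Gamma (β + 1) * z ^ (-(β + 1)) =
      ∫ u in Ioi (0 : ℝ), u ^ β * Real.exp (-(z * u)) * (max (2 - u) 0 ^ β - 2 ^ β) := by
    rw [mul_assoc, ← integral_rpow_mul_exp_neg_mul (by linarith) hz, ← integral_const_mul, hw,
      sub_eq_iff_eq_add, ← integral_add hdiff (hmain.const_mul _)]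
    congr 1
    ext u
    ring
  rw [hsplit, ← Real.norm_eq_abs]
  refine (norm_integral_le_of_norm_le (hnext.const_mul (β * 2 ^ (β - 1))) hae).trans_eq ?_
  rw [integral_const_mul, integral_rpow_mul_exp_neg_mul (by linarith) hz,
    show β + 1 + 1 = β + 2 by ring]
  ring

/-! ### Poisson's integral for the Bessel series. -/

/-- The substitution s = 2u - 1 gives a Beta integral with equal parameters, which Legendre's
duplication formula simplifies. -/
theorem integral_one_sub_sq_rpow {β : ℝ} (hβ : -1 < β) :
    ∫ s in (-1 : ℝ)..1, (1 - s ^ 2) ^ β =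
      Real.sqrt Real.pi * Real.Gamma (β + 1) / Real.Gamma (β + 3 / 2) := by
  have hb : ∫ u in (0 : ℝ)..1, u ^ β * (1 - u) ^ β =
      Real.Gamma (β + 1) * Real.Gamma (β + 1) / Real.Gamma (β + 1 + (β + 1)) := by
    have h := ProbabilityTheory.beta_eq_betaIntegralReal (β + 1) (β + 1) (by linarith)
      (by linarith)
    rw [ProbabilityTheory.beta] at h
    rw [h, Complex.betaIntegral]
    have : ∀ u ∈ uIcc (0 : ℝ) 1, (u : ℂ) ^ (((β + 1 : ℝ) : ℂ) - 1) *
        (1 - (u : ℂ)) ^ (((β + 1 : ℝ) : ℂ) - 1) = ((u ^ β * (1 - u) ^ β : ℝ) : ℂ) := by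
      intro u hu
      rw [uIcc_of_le zero_le_one] at hu
      push_cast
      rw [add_sub_cancel_right, Complex.ofReal_cpow hu.1, Complex.ofReal_cpow (by linarith [hu.2])]
      push_cast
      rfl
    rw [intervalIntegral.integral_congr this, intervalIntegral.integral_ofReal, Complex.ofReal_re]
  have hsub : ∫ s in (-1 : ℝ)..1, (1 - s ^ 2) ^ β =
      2 * 4 ^ β * ∫ u in (0 : ℝ)..1, u ^ β * (1 - u) ^ β := by
    have h := intervalIntegral.smul_integral_comp_mul_sub (a := 0) (b := 1)
      (fun s : ℝ => (1 - s ^ 2) ^ β) 2 1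
    norm_num at h
    rw [← h, mul_assoc, ← intervalIntegral.integral_const_mul (4 ^ β)]
    refine congrArg ((2 : ℝ) * ·) (intervalIntegral.integral_congr fun u hu => ?_)
    rw [uIcc_of_le zero_le_one] at hu
    have h1 : 0 ≤ 1 - u := by linarith [hu.2]
    rw [← Real.mul_rpow hu.1 h1, ← Real.mul_rpow (by norm_num) (mul_nonneg hu.1 h1)]
    ring_nf
  have hdup := Real.Gamma_mul_Gamma_add_half (β + 1)
  rw [show β + 1 + 1 / 2 = β + 3 / 2 by ring] at hdup
  have g1 : 0 < Real.Gamma (β + 3 / 2) := Real.Gamma_pos_of_pos (by linarith)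
  have g2 : 0 < Real.Gamma (2 * (β + 1)) := Real.Gamma_pos_of_pos (by linarith)
  rw [hsub, hb, show β + 1 + (β + 1) = 2 * (β + 1) by ring, eq_div_iff g1.ne']
  have h4 : (2 : ℝ) * 4 ^ β * 2 ^ (1 - 2 * (β + 1)) = 1 := by
    rw [show (4 : ℝ) = 2 ^ (2 : ℝ) by norm_num, ← Real.rpow_mul (by norm_num), mul_assoc,
      ← Real.rpow_add (by norm_num), show 2 * β + (1 - 2 * (β + 1)) = -1 by ring,
      Real.rpow_neg_one]
    norm_num
  have : Real.Gamma (β + 1) * (Real.Gamma (β + 1) * Real.Gamma (β + 3 / 2)) =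
      Real.Gamma (β + 1) * (Real.Gamma (2 * (β + 1)) * 2 ^ (1 - 2 * (β + 1)) * √Real.pi) := by
    rw [hdup]
  generalize Real.Gamma (β + 3 / 2) = G at *
  generalize Real.Gamma (2 * (β + 1)) = G' at *
  field_simp
  linear_combination 2 * 4 ^ β * this +
    Real.Gamma (β + 1) * G' * √Real.pi * h4

/-- Integrate the derivative of s^(2m+1) (1-s²)^(β+1), which vanishes at both ends. -/
theorem integral_pow_mul_one_sub_sq_rpow_succ {β : ℝ} (hβ : 0 ≤ β) (m : ℕ) :
    (2 * m + 2 * β + 3) * ∫ s in (-1 : ℝ)..1, s ^ (2 * (m + 1)) * (1 - s ^ 2) ^ β =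
      (2 * m + 1) * ∫ s in (-1 : ℝ)..1, s ^ (2 * m) * (1 - s ^ 2) ^ β := by
  have hc : ∀ n : ℕ, Continuous fun s : ℝ => s ^ n * (1 - s ^ 2) ^ β := fun n =>
    (continuous_pow n).mul
      ((by fun_prop : Continuous fun s : ℝ => 1 - s ^ 2).rpow_const fun _ => Or.inr hβ)
  have hi : ∀ n : ℕ, IntervalIntegrable (fun s : ℝ => s ^ n * (1 - s ^ 2) ^ β) volume (-1) 1 :=
    fun n => (hc n).intervalIntegrable _ _
  have h := intervalIntegral.integral_eq_sub_of_hasDerivAt (a := -1) (b := 1)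
    (f := fun s : ℝ => s ^ (2 * m + 1) * (1 - s ^ 2) ^ (β + 1))
    (f' := fun s => (2 * m + 1) * (s ^ (2 * m) * (1 - s ^ 2) ^ β) -
      (2 * m + 2 * β + 3) * (s ^ (2 * (m + 1)) * (1 - s ^ 2) ^ β)) ?_
    (((hi _).const_mul _).sub ((hi _).const_mul _))
  · rw [intervalIntegral.integral_sub ((hi _).const_mul _) ((hi _).const_mul _),
      intervalIntegral.integral_const_mul, intervalIntegral.integral_const_mul] at h
    norm_num [Real.zero_rpow (by linarith : β + 1 ≠ 0)] at h
    linarith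
  · intro s hs
    rw [uIcc_of_le (by norm_num)] at hs
    have h0 : 0 ≤ 1 - s ^ 2 := by nlinarith [hs.1, hs.2]
    have h1 : HasDerivAt (fun s : ℝ => 1 - s ^ 2) (-(2 * s)) s := by
      simpa using (hasDerivAt_pow 2 s).const_sub 1
    have h2 := h1.rpow_const (p := β + 1) (Or.inr (by linarith))
    have h3 := (hasDerivAt_pow (2 * m + 1) s).mul h2
    convert! h3 using 1
    have h4 : (1 - s ^ 2) ^ (β + 1) = (1 - s ^ 2) ^ β * (1 - s ^ 2) := by
      rcases h0.eq_or_lt with h | h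
      · rw [← h, Real.zero_rpow (by linarith), mul_zero]
      · exact Real.rpow_add_one h.ne' _
    rw [h4]
    push_cast
    simp only [add_sub_cancel_right]
    ring

theorem integral_pow_mul_one_sub_sq_rpow {β : ℝ} (hβ : 0 ≤ β) (m : ℕ) :
    ∫ s in (-1 : ℝ)..1, s ^ (2 * m) * (1 - s ^ 2) ^ β =
      (2 * m).factorial * (Real.sqrt Real.pi * Real.Gamma (β + 1)) /
        (4 ^ m * m.factorial * Real.Gamma (m + β + 3 / 2)) := by
  induction m with
  | zero => simpa using integral_one_sub_sq_rpow (by linarith : -1 < β)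
  | succ m ih =>
    have h := integral_pow_mul_one_sub_sq_rpow_succ hβ m
    rw [ih] at h
    have hp : (0 : ℝ) < m + β + 3 / 2 := by positivity
    have hg : 0 < Real.Gamma (m + β + 3 / 2) := Real.Gamma_pos_of_pos hp
    have hG : Real.Gamma (((m + 1 : ℕ) : ℝ) + β + 3 / 2) =
        (m + β + 3 / 2) * Real.Gamma (m + β + 3 / 2) := by
      rw [← Real.Gamma_add_one hp.ne']
      push_cast
      ring_nf
    rw [hG, show 2 * (m + 1) = 2 * m + 1 + 1 by ring, Nat.factorial_succ, Nat.factorial_succ,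
      Nat.factorial_succ, show 2 * m + 1 + 1 = 2 * (m + 1) by ring]
    have hd : (0 : ℝ) < 2 * m + 2 * β + 3 := by positivity
    refine mul_left_cancel₀ hd.ne' (h.trans ?_)
    push_cast
    field_simp
    ring

/-- The `m`-th term of the series of `2^α z^(-α) I_α(z)`. -/
noncomputable def besselTerm (α z : ℝ) (m : ℕ) : ℝ :=
  (z / 2) ^ (2 * m) / (m.factorial * Real.Gamma (m + α + 1))

/-- With s = 1 - u the right side is the integral of e^(zs) (1-s²)^β over [-1,1]. The weight is
even, so e^(zs) may be replaced by cosh(zs), whose power series is integrated term by term. -/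
theorem hasSum_besselTerm_poisson {β : ℝ} (hβ : 0 ≤ β) (z : ℝ) :
    HasSum (fun m => Real.sqrt Real.pi * Real.Gamma (β + 1) * besselTerm (β + 1 / 2) z m)
      (Real.exp z * laplaceWeight β 0 z) := by
  have hw : Continuous fun s : ℝ => (1 - s ^ 2) ^ β :=
    (by fun_prop : Continuous fun s : ℝ => 1 - s ^ 2).rpow_const fun _ => Or.inr hβ
  have h1 : Real.exp z * laplaceWeight β 0 z =
      ∫ s in (-1 : ℝ)..1, Real.exp (z * s) * (1 - s ^ 2) ^ β := by
    rw [laplaceWeight, ← intervalIntegral.integral_const_mul]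
    have := intervalIntegral.integral_comp_sub_left (a := 0) (b := 2)
      (fun s : ℝ => Real.exp (z * s) * (1 - s ^ 2) ^ β) 1
    norm_num at this
    rw [← this]
    congr 1
    ext u
    rw [pow_zero, one_mul, ← mul_assoc, ← Real.exp_add]
    ring_nf
  have h2 : ∫ s in (-1 : ℝ)..1, Real.exp (z * s) * (1 - s ^ 2) ^ β =
      ∫ s in (-1 : ℝ)..1, Real.exp (-(z * s)) * (1 - s ^ 2) ^ β := by
    have := intervalIntegral.integral_comp_neg (a := -1) (b := 1)
      (fun s : ℝ => Real.exp (z * s) * (1 - s ^ 2) ^ β)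
    norm_num at this
    exact this.symm
  have h3 : Real.exp z * laplaceWeight β 0 z =
      ∫ s in (-1 : ℝ)..1, Real.cosh (z * s) * (1 - s ^ 2) ^ β := by
    have hi1 : IntervalIntegrable (fun s : ℝ => Real.exp (z * s) * (1 - s ^ 2) ^ β)
        volume (-1) 1 := by
      refine Continuous.intervalIntegrable (Continuous.mul (by fun_prop) hw) _ _
    have hi2 : IntervalIntegrable (fun s : ℝ => Real.exp (-(z * s)) * (1 - s ^ 2) ^ β)
        volume (-1) 1 := by
      refine Continuous.intervalIntegrable (Continuous.mul (by fun_prop) hw) _ _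
    have : ∫ s in (-1 : ℝ)..1, Real.cosh (z * s) * (1 - s ^ 2) ^ β =
        1 / 2 * ((∫ s in (-1 : ℝ)..1, Real.exp (z * s) * (1 - s ^ 2) ^ β) +
          ∫ s in (-1 : ℝ)..1, Real.exp (-(z * s)) * (1 - s ^ 2) ^ β) := by
      rw [← intervalIntegral.integral_add hi1 hi2, ← intervalIntegral.integral_const_mul]
      congr 1
      ext s
      rw [Real.cosh_eq]
      ring
    rw [this, ← h2, ← h1]
    ring
  rw [h3]
  have key := intervalIntegral.hasSum_integral_of_dominated_convergence
    (μ := volume) (a := -1) (b := 1)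
    (F := fun (m : ℕ) (s : ℝ) => (z * s) ^ (2 * m) / (2 * m).factorial * (1 - s ^ 2) ^ β)
    (f := fun s => Real.cosh (z * s) * (1 - s ^ 2) ^ β)
    (fun m _ => z ^ (2 * m) / (2 * m).factorial)
    (fun m => (Continuous.mul (by fun_prop) hw).aestronglyMeasurable)
    ?_ (Eventually.of_forall fun _ _ => (Real.hasSum_cosh z).summable)
    (by simp) (Eventually.of_forall fun s _ => (Real.hasSum_cosh (z * s)).mul_right _)
  · convert! key using 1
    ext m
    have : ∫ s in (-1 : ℝ)..1, (z * s) ^ (2 * m) / (2 * m).factorial * (1 - s ^ 2) ^ β =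
        z ^ (2 * m) / (2 * m).factorial * ∫ s in (-1 : ℝ)..1, s ^ (2 * m) * (1 - s ^ 2) ^ β := by
      rw [← intervalIntegral.integral_const_mul]
      congr 1
      ext s
      rw [mul_pow]
      ring
    rw [this, integral_pow_mul_one_sub_sq_rpow hβ, besselTerm, div_pow,
      show (2 : ℝ) ^ (2 * m) = 4 ^ m by rw [pow_mul]; norm_num,
      show (m : ℝ) + (β + 1 / 2) + 1 = m + β + 3 / 2 by ring]
    have : (0 : ℝ) < (2 * m).factorial := by positivity
    field_simp
  · refine fun m => Eventually.of_forall fun s hs => ?_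
    rw [uIoc_of_le (by norm_num)] at hs
    have hs1 : s ^ 2 ≤ 1 := by nlinarith [hs.1, hs.2]
    have e1 : (1 - s ^ 2) ^ β ≤ 1 := Real.rpow_le_one (by linarith) (by nlinarith) hβ
    have e2 : 0 ≤ (1 - s ^ 2) ^ β := Real.rpow_nonneg (by linarith) _
    have e3 : (z * s) ^ (2 * m) ≤ z ^ (2 * m) := by
      rw [pow_mul, pow_mul]
      exact pow_le_pow_left₀ (sq_nonneg _) (by nlinarith [sq_nonneg z]) m
    have e5 : 0 ≤ z ^ (2 * m) := by rw [pow_mul]; positivity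
    have e4 : 0 ≤ (z * s) ^ (2 * m) := by rw [pow_mul]; positivity
    rw [Real.norm_eq_abs, abs_of_nonneg (by positivity)]
    calc _ ≤ z ^ (2 * m) / (2 * m).factorial * 1 := by gcongr
      _ = _ := mul_one _

/-! ### The Bessel symbol for every α > -1. -/

/-- `Φ(z) = e^(-z) z^(-α) I_α(z)`, with the symbol estimates and the leading
asymptotics of `I_α` at infinity. -/
structure IsBesselSymbol (α : ℝ) (Φ : ℝ → ℝ) : Prop where
  hasSum : ∀ z, HasSum (besselTerm α z) (2 ^ α * (Real.exp z * Φ z))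
  symbol : IsSymbol (-(α + 1 / 2)) Φ
  asymp : ∃ C, 0 ≤ C ∧ ∀ z, 1 ≤ z → |z ^ (α + 1 / 2) * Φ z - 1 / √(2 * Real.pi)| ≤ C / z

theorem isBesselSymbol_laplaceWeight {β : ℝ} (hβ : 1 ≤ β) :
    IsBesselSymbol (β + 1 / 2)
      (fun z => (√Real.pi * Real.Gamma (β + 1) * 2 ^ (β + 1 / 2))⁻¹ * laplaceWeight β 0 z) := by
  have hG : 0 < Real.Gamma (β + 1) := Real.Gamma_pos_of_pos (by linarith)
  have hG2 : 0 < Real.Gamma (β + 2) := Real.Gamma_pos_of_pos (by linarith)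
  have hpi : 0 < √Real.pi := Real.sqrt_pos.2 Real.pi_pos
  have h2 : (0 : ℝ) < 2 ^ (β + 1 / 2) := by positivity
  refine ⟨fun z => ?_, ?_, ?_⟩
  · have := (hasSum_besselTerm_poisson (by linarith : 0 ≤ β) z).mul_left
      (√Real.pi * Real.Gamma (β + 1))⁻¹
    convert! this using 1
    · ext m
      field_simp
    · field_simp
  · rw [show -(β + 1 / 2 + 1 / 2) = -(β + 1) by ring]
    exact (isSymbol_laplaceWeight (by linarith)).const_mul _
  · set c := (√Real.pi * Real.Gamma (β + 1) * 2 ^ (β + 1 / 2))⁻¹ with hc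
    have hcpos : 0 < c := by positivity
    refine ⟨c * (β * 2 ^ (β - 1) * Real.Gamma (β + 2)), by positivity, fun z hz => ?_⟩
    have hz0 : 0 < z := by linarith
    have hlim : 1 / √(2 * Real.pi) =
        z ^ (β + 1) * (c * (2 ^ β * Real.Gamma (β + 1) * z ^ (-(β + 1)))) := by
      rw [Real.rpow_neg hz0.le, hc, Real.rpow_add (by norm_num : (0 : ℝ) < 2),
        ← Real.sqrt_eq_rpow, Real.sqrt_mul (by norm_num)]
      field_simp
    rw [show β + 1 / 2 + 1 / 2 = β + 1 by ring, hlim, ← mul_sub, ← mul_sub, abs_mul, abs_mul,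
      abs_of_pos hcpos, abs_of_pos (by positivity)]
    calc _ ≤ z ^ (β + 1) * (c * (β * 2 ^ (β - 1) * Real.Gamma (β + 2) * z ^ (-(β + 2)))) := by
          gcongr
          exact abs_laplaceWeight_sub_le hβ hz0
      _ = c * (β * 2 ^ (β - 1) * Real.Gamma (β + 2)) * (z ^ (β + 1) * z ^ (-(β + 2))) := by ring
      _ = _ := by
          rw [← Real.rpow_add hz0, show β + 1 + -(β + 2) = -1 by ring, Real.rpow_neg_one]
          rfl

/-- This is the recurrence I_α = I_(α+2) + (2(α+1)/z) I_(α+1). The first summand has the right order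
and carries the leading asymptotics; the second is of order one lower and only enters the O(1/z)
error. -/
theorem IsBesselSymbol.descend {α : ℝ} (hα : -1 < α) {Φ Ψ : ℝ → ℝ}
    (hΦ : IsBesselSymbol (α + 1) Φ) (hΨ : IsBesselSymbol (α + 2) Ψ) :
    IsBesselSymbol α ((fun z => z * (z * Ψ z)) + fun z => 2 * (α + 1) * Φ z) := by
  have hα1 : 0 < α + 1 := by linarith
  refine ⟨fun z => ?_, ?_, ?_⟩
  · have h1 : HasSum (fun m => besselTerm α z m - (α + 1) * besselTerm (α + 1) z m)
        (z ^ 2 / 4 * (2 ^ (α + 2) * (Real.exp z * Ψ z))) := by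
      -- The term `m = 0` of the difference vanishes because Γ(α+2) = (α+1) Γ(α+1); the shifted
      -- series is z²/4 times that of order α + 2.
      rw [← hasSum_nat_add_iff' 1]
      convert! (hΨ.hasSum z).mul_left (z ^ 2 / 4) using 1
      · ext m
        have hp : 0 < (m : ℝ) + α + 2 := by
          have : (0 : ℝ) ≤ m := by positivity
          linarith
        have hg : 0 < Real.Gamma ((m : ℝ) + α + 2) := Real.Gamma_pos_of_pos hp
        have e : Real.Gamma ((m : ℝ) + (α + 2) + 1) =
            (m + α + 2) * Real.Gamma ((m : ℝ) + α + 2) := by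
          rw [← Real.Gamma_add_one hp.ne']; ring_nf
        simp only [besselTerm]
        push_cast
        rw [show (m : ℝ) + 1 + α + 1 = m + α + 2 by ring,
          show (m : ℝ) + 1 + (α + 1) + 1 = m + (α + 2) + 1 by ring, e, Nat.factorial_succ]
        push_cast
        field_simp
        ring
      · have hg : 0 < Real.Gamma (α + 1) := Real.Gamma_pos_of_pos hα1
        simp only [Finset.sum_range_one, besselTerm]
        rw [show ((0 : ℕ) : ℝ) + (α + 1) + 1 = α + 1 + 1 by push_cast; ring,
          Real.Gamma_add_one hα1.ne']
        simp
        field_simp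
        ring
    convert! h1.add ((hΦ.hasSum z).mul_left (α + 1)) using 1
    · ext m
      ring
    · rw [show α + 2 = α + 1 + 1 by ring, Real.rpow_add_one (by norm_num),
        Real.rpow_add_one (by norm_num)]
      simp only [Pi.add_apply]
      ring
  · refine IsSymbol.add ?_ ((hΦ.symbol.mono (by linarith)).const_mul _)
    have := hΨ.symbol.id_mul.id_mul
    convert this using 1
    ring
  · obtain ⟨C, hC, hb⟩ := hΨ.asymp
    obtain ⟨C', hC', hb'⟩ := hΦ.symbol.2 0
    refine ⟨C + 2 * (α + 1) * C', by positivity, fun z hz => ?_⟩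
    have hz0 : 0 < z := by linarith
    have e1 : z ^ (α + 1 / 2) * (z * (z * Ψ z)) = z ^ (α + 2 + 1 / 2) * Ψ z := by
      rw [show α + 2 + 1 / 2 = α + 1 / 2 + 1 + 1 by ring, Real.rpow_add_one hz0.ne',
        Real.rpow_add_one hz0.ne']
      ring
    have e2 : |z ^ (α + 1 / 2) * (2 * (α + 1) * Φ z)| ≤ 2 * (α + 1) * C' / z := by
      rw [abs_mul, abs_mul, abs_of_pos (by positivity), abs_of_pos (by positivity)]
      have h3 : |Φ z| ≤ C' * z ^ (-(α + 1 / 2) - 1) := by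
        have := hb' z hz0.le
        simp only [iteratedDeriv_zero, Nat.cast_zero, sub_zero] at this
        refine this.trans ?_
        rw [show -(α + 1 / 2) - 1 = -(α + 1 + 1 / 2) by ring]
        gcongr C' * ?_
        refine Real.rpow_le_rpow_of_nonpos hz0 (by linarith) (by linarith)
      calc _ ≤ z ^ (α + 1 / 2) * (2 * (α + 1) * (C' * z ^ (-(α + 1 / 2) - 1))) := by gcongr
        _ = 2 * (α + 1) * C' * (z ^ (α + 1 / 2) * z ^ (-(α + 1 / 2) - 1)) := by ring
        _ = _ := by
          rw [← Real.rpow_add hz0, show α + 1 / 2 + (-(α + 1 / 2) - 1) = -1 by ring,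
            Real.rpow_neg_one]
          rfl
    simp only [Pi.add_apply]
    rw [mul_add, e1, add_sub_right_comm, add_div]
    exact (abs_add_le _ _).trans (add_le_add (hb z hz) e2)

/-- Induction on the number of unit steps needed to bring α above 3/2, where Poisson's integral
applies with β = α - 1/2 > 1. -/
theorem exists_isBesselSymbol {α : ℝ} (hα : -1 < α) : ∃ Φ, IsBesselSymbol α Φ := by
  obtain ⟨n, hn⟩ := exists_nat_gt (3 / 2 - α)
  induction n generalizing α with
  | zero =>
    have := isBesselSymbol_laplaceWeight (β := α - 1 / 2) (by push_cast at hn; linarith)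
    rw [sub_add_cancel] at this
    exact ⟨_, this⟩
  | succ n ih =>
    push_cast at hn
    obtain ⟨Φ, hΦ⟩ := ih (α := α + 1) (by linarith) (by linarith)
    obtain ⟨Ψ, hΨ⟩ := ih (α := α + 2) (by linarith) (by linarith)
    exact ⟨_, hΦ.descend hα hΨ⟩

theorem IsBesselSymbol.besselI_eq {α : ℝ} {Φ : ℝ → ℝ} (hΦ : IsBesselSymbol α Φ) {z : ℝ}
    (hz : 0 < z) : besselI α z = z ^ α * (Real.exp z * Φ z) := by
  have h := ((hΦ.hasSum z).mul_left ((z / 2) ^ α)).tsum_eq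
  rw [Real.div_rpow hz.le (by norm_num)] at h
  rw [besselI]
  have h2 : (0 : ℝ) < 2 ^ α := by positivity
  rw [show z ^ α * (Real.exp z * Φ z) = z ^ α / 2 ^ α * (2 ^ α * (Real.exp z * Φ z)) by field_simp,
    ← h]
  congr 1
  ext m
  rw [besselTerm, add_comm (2 * (m : ℝ)), Real.rpow_add (by positivity),
    Real.div_rpow hz.le (by norm_num), mul_div_assoc]
  norm_cast

/-- The series holds for all real z and contains only even powers. This parity is what improves the
odd case. -/
theorem IsBesselSymbol.even {α : ℝ} {Φ : ℝ → ℝ} (hΦ : IsBesselSymbol α Φ) (z : ℝ) :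
    Real.exp (-z) * Φ (-z) = Real.exp z * Φ z := by
  have h1 := hΦ.hasSum (-z)
  have h2 := hΦ.hasSum z
  have : besselTerm α (-z) = besselTerm α z := by
    ext m
    simp only [besselTerm]
    rw [neg_div, Even.neg_pow (even_two_mul m)]
  rw [this] at h1
  exact mul_left_cancel₀ (by positivity) (h1.unique h2)

/-! ### Derivatives of Gaussians and of symbols times Gaussians. -/

theorem abs_pow_le_mul_exp_sq {ε : ℝ} (hε : 0 < ε) (n : ℕ) :
    ∃ C, 0 ≤ C ∧ ∀ v : ℝ, |v| ^ n ≤ C * Real.exp (ε * v ^ 2) := by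
  refine ⟨1 + n.factorial / ε ^ n, by positivity, fun v => ?_⟩
  have h1 : |v| ^ n ≤ 1 + (v ^ 2) ^ n := by
    rw [← sq_abs, ← pow_mul, mul_comm 2 n, pow_mul]
    nlinarith [sq_nonneg (|v| ^ n - 1), sq_nonneg (|v| ^ n)]
  have h2 : (v ^ 2) ^ n ≤ n.factorial / ε ^ n * Real.exp (ε * v ^ 2) := by
    have := Real.pow_div_factorial_le_exp (x := ε * v ^ 2) (by positivity) n
    rw [mul_pow] at this
    have hf : (0 : ℝ) < n.factorial := by positivity
    rw [div_le_iff₀ hf] at this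
    rw [div_mul_eq_mul_div, le_div_iff₀ (by positivity)]
    linarith
  have h3 : 1 ≤ Real.exp (ε * v ^ 2) := Real.one_le_exp (by positivity)
  linarith

theorem Polynomial.abs_eval_le_mul_exp_sq {ε : ℝ} (hε : 0 < ε) (p : Polynomial ℝ) :
    ∃ C, 0 ≤ C ∧ ∀ v : ℝ, |p.eval v| ≤ C * Real.exp (ε * v ^ 2) := by
  induction p using Polynomial.induction_on' with
  | add p q hp hq =>
    obtain ⟨C, hC, h⟩ := hp
    obtain ⟨C', hC', h'⟩ := hq
    refine ⟨C + C', by positivity, fun v => ?_⟩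
    rw [Polynomial.eval_add, add_mul]
    exact (abs_add_le _ _).trans (add_le_add (h v) (h' v))
  | monomial n a =>
    obtain ⟨C, hC, h⟩ := abs_pow_le_mul_exp_sq hε n
    refine ⟨|a| * C, by positivity, fun v => ?_⟩
    rw [Polynomial.eval_monomial, abs_mul, abs_pow, mul_assoc]
    exact mul_le_mul_of_nonneg_left (h v) (abs_nonneg a)

theorem abs_hermite_le_mul_exp_sq (n : ℕ) :
    ∃ C, 0 ≤ C ∧ ∀ v : ℝ, |Polynomial.aeval v (Polynomial.hermite n)| ≤
      C * Real.exp (v ^ 2 / 8) := by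
  obtain ⟨C, hC, h⟩ := Polynomial.abs_eval_le_mul_exp_sq (ε := 1 / 8) (by norm_num)
    ((Polynomial.hermite n).map (Int.castRingHom ℝ))
  refine ⟨C, hC, fun v => ?_⟩
  have := h v
  rw [Polynomial.eval_map] at this
  rw [Polynomial.aeval_def]
  convert! this using 3
  ring

theorem iteratedDeriv_exp_mul_sub_sq {a : ℝ} (ha : 0 < a) (b : ℝ) (m : ℕ) (u : ℝ) :
    iteratedDeriv m (fun u => Real.exp (b * u - a * u ^ 2)) u =
      (-√(2 * a)) ^ m * Polynomial.aeval (√(2 * a) * u - b / √(2 * a)) (Polynomial.hermite m) *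
        Real.exp (b * u - a * u ^ 2) := by
  set s := √(2 * a) with hs
  have hs0 : 0 < s := Real.sqrt_pos.2 (by positivity)
  have hss : s ^ 2 = 2 * a := Real.sq_sqrt (by positivity)
  -- Completing the square reduces to the standard Gaussian and Rodrigues' formula.
  have hexp : ∀ u, Real.exp (b * u - a * u ^ 2) =
      Real.exp (b ^ 2 / (4 * a)) * Real.exp (-((s * u - b / s) ^ 2 / 2)) := by
    intro u
    rw [← Real.exp_add]
    congr 1
    have : (b / s) ^ 2 = b ^ 2 / (2 * a) := by rw [div_pow, hss]
    have h2 : (s * u - b / s) ^ 2 = 2 * a * u ^ 2 - 2 * b * u + b ^ 2 / (2 * a) := by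
      rw [sub_sq, this, mul_pow, hss]
      field_simp
    rw [h2]
    field_simp
    ring
  have hsm : ContDiff ℝ m (fun y : ℝ => Real.exp (-((y - b / s) ^ 2 / 2))) := by fun_prop
  have h1 := congrFun (iteratedDeriv_comp_const_mul (n := m) hsm s) u
  have h2 := congrFun (iteratedDeriv_comp_sub_const m
    (fun y : ℝ => Real.exp (-(y ^ 2 / 2))) (b / s)) (s * u)
  rw [funext hexp, iteratedDeriv_const_mul_field, h1, h2, hexp u, iteratedDeriv_eq_iterate,
    Polynomial.deriv_gaussian_eq_hermite_mul_gaussian, neg_pow s]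
  ring

/-- The Gaussian factor of the Mehler type kernels, as a function of `x`. -/
noncomputable def gaussExp (a b u : ℝ) : ℝ :=
  Real.exp (b * u - a * u ^ 2)

theorem contDiff_gaussExp (a b : ℝ) : ContDiff ℝ ∞ (gaussExp a b) := by
  unfold gaussExp
  fun_prop

/-- With v = √(2a) u - b/√(2a), the exponent bu - au² equals b²/(4a) - v²/2. Absorbing the Hermite
polynomial into e^(v²/8) therefore costs one quarter of it and adds b²/(16a). -/
theorem abs_iteratedDeriv_gaussExp_le (m : ℕ) : ∃ C, 0 ≤ C ∧ ∀ a b u : ℝ, 0 < a →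
    |iteratedDeriv m (gaussExp a b) u| ≤
      C * √(2 * a) ^ m * Real.exp (3 / 4 * (b * u - a * u ^ 2) + b ^ 2 / (16 * a)) := by
  obtain ⟨H, hH, hHb⟩ := abs_hermite_le_mul_exp_sq m
  refine ⟨H, hH, fun a b u ha => ?_⟩
  have hss : √(2 * a) ^ 2 = 2 * a := Real.sq_sqrt (by positivity)
  have hexp : Real.exp ((√(2 * a) * u - b / √(2 * a)) ^ 2 / 8) * Real.exp (b * u - a * u ^ 2) =
      Real.exp (3 / 4 * (b * u - a * u ^ 2) + b ^ 2 / (16 * a)) := by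
    have hs0 : 0 < √(2 * a) := Real.sqrt_pos.2 (by positivity)
    rw [← Real.exp_add]
    congr 1
    have : (b / √(2 * a)) ^ 2 = b ^ 2 / (2 * a) := by rw [div_pow, hss]
    have h2 : (√(2 * a) * u - b / √(2 * a)) ^ 2 =
        2 * a * u ^ 2 - 2 * b * u + b ^ 2 / (2 * a) := by
      rw [sub_sq, this, mul_pow, hss]
      field_simp
    rw [h2]
    field_simp
    ring
  unfold gaussExp
  rw [iteratedDeriv_exp_mul_sub_sq ha, abs_mul, abs_mul, abs_pow, abs_neg, Real.abs_exp,
    abs_of_nonneg (Real.sqrt_nonneg _), ← hexp]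
  calc _ ≤ √(2 * a) ^ m * (H * Real.exp ((√(2 * a) * u - b / √(2 * a)) ^ 2 / 8)) *
        Real.exp (b * u - a * u ^ 2) := by
        gcongr
        exact hHb _
    _ = _ := by ring

/-- The function whose `x`-derivatives give the powers of `𝔇_α` applied to the heat kernel. -/
noncomputable def besselGauss (Φ : ℝ → ℝ) (a b u : ℝ) : ℝ :=
  Φ (b * u) * gaussExp a b u

theorem contDiff_besselGauss {Φ : ℝ → ℝ} (hΦ : ContDiff ℝ ∞ Φ) (a b : ℝ) :
    ContDiff ℝ ∞ (besselGauss Φ a b) :=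
  (hΦ.comp (by fun_prop : ContDiff ℝ ∞ fun u : ℝ => b * u)).mul (contDiff_gaussExp a b)

theorem iteratedDeriv_besselGauss {Φ : ℝ → ℝ} (hΦ : ContDiff ℝ ∞ Φ) (a b : ℝ)
    (n : ℕ) (u : ℝ) :
    iteratedDeriv n (besselGauss Φ a b) u = ∑ i ∈ Finset.range (n + 1),
      n.choose i * (b ^ i * iteratedDeriv i Φ (b * u)) *
        iteratedDeriv (n - i) (gaussExp a b) u := by
  have h1 : ContDiff ℝ n fun u => Φ (b * u) :=
    (hΦ.comp (by fun_prop : ContDiff ℝ ∞ fun u : ℝ => b * u)).of_le (by exact_mod_cast le_top)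
  have h2 : ContDiff ℝ n (gaussExp a b) := (contDiff_gaussExp a b).of_le (by exact_mod_cast le_top)
  refine (iteratedDeriv_mul h1.contDiffAt h2.contDiffAt).trans (Finset.sum_congr rfl fun i _ => ?_)
  have h3 : ContDiff ℝ i Φ := hΦ.of_le (by exact_mod_cast le_top)
  rw [congrFun (iteratedDeriv_comp_const_mul h3 b) u]

/-- Every derivative of Φ is bounded crudely by 1 + bu. Order at most 1 suffices for this, and it
covers both -(α+1/2) with α > -1 and the constant symbol of the Hermite case. -/
theorem abs_iteratedDeriv_besselGauss_le {Φ : ℝ → ℝ} {ρ : ℝ} (hρ : ρ ≤ 1) (hΦ : IsSymbol ρ Φ)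
    (n : ℕ) : ∃ C, 0 ≤ C ∧ ∀ a b u : ℝ, 0 < a → 0 ≤ b → 0 ≤ u →
      |iteratedDeriv n (besselGauss Φ a b) u| ≤ C * (1 + b * u) * (b + √(2 * a)) ^ n *
        Real.exp (3 / 4 * (b * u - a * u ^ 2) + b ^ 2 / (16 * a)) := by
  choose C hC hCb using hΦ.2
  choose H hH hHb using abs_iteratedDeriv_gaussExp_le
  refine ⟨∑ i ∈ Finset.range (n + 1), C i * H (n - i),
    Finset.sum_nonneg fun i _ => mul_nonneg (hC _) (hH _), fun a b u ha hb hu => ?_⟩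
  set E := Real.exp (3 / 4 * (b * u - a * u ^ 2) + b ^ 2 / (16 * a)) with hE
  have hz : 0 ≤ b * u := by positivity
  rw [iteratedDeriv_besselGauss hΦ.1]
  refine (Finset.abs_sum_le_sum_abs _ _).trans ?_
  rw [add_pow, Finset.mul_sum, Finset.sum_mul]
  refine Finset.sum_le_sum fun i hi => ?_
  have hsum : C i * H (n - i) ≤ ∑ i ∈ Finset.range (n + 1), C i * H (n - i) :=
    Finset.single_le_sum (f := fun i => C i * H (n - i))
      (fun i _ => mul_nonneg (hC _) (hH _)) hi
  have e1 : |iteratedDeriv i Φ (b * u)| ≤ C i * (1 + b * u) := by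
    refine (hCb i _ hz).trans (mul_le_mul_of_nonneg_left ?_ (hC i))
    calc (1 + b * u) ^ (ρ - i) ≤ (1 + b * u) ^ (1 : ℝ) := by
          gcongr
          · linarith
          · have : (0 : ℝ) ≤ i := by positivity
            linarith
      _ = _ := Real.rpow_one _
  rw [abs_mul, abs_mul, abs_mul, abs_pow, Nat.abs_cast, abs_of_nonneg hb]
  have hHn := hH (n - i)
  have hCi := hC i
  calc _ ≤ (n.choose i : ℝ) * (b ^ i * (C i * (1 + b * u))) *
        (H (n - i) * √(2 * a) ^ (n - i) * E) := by
        gcongr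
        exact hHb _ _ _ _ ha
    _ = C i * H (n - i) * ((1 + b * u) * (b ^ i * √(2 * a) ^ (n - i) * n.choose i) * E) := by
        ring
    _ ≤ (∑ i ∈ Finset.range (n + 1), C i * H (n - i)) *
        ((1 + b * u) * (b ^ i * √(2 * a) ^ (n - i) * n.choose i) * E) := by
        gcongr
    _ = _ := by ring

/-! ### Conjugating the operators to d/dx and rewriting the kernels. -/

/-- The weight w = u^(α+1/2) e^(-u²/2) is annihilated by 𝔇_α, hence 𝔇_α(w g) = w g'. -/
theorem laguerreD_iterate_eq {α : ℝ} {f g : ℝ → ℝ} (hg : ContDiff ℝ ∞ g)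
    (h : ∀ u, 0 < u → f u = u ^ (α + 1 / 2) * Real.exp (-(u ^ 2 / 2)) * g u) (k : ℕ) :
    ∀ u, 0 < u → (laguerreD α)^[k] f u =
      u ^ (α + 1 / 2) * Real.exp (-(u ^ 2 / 2)) * iteratedDeriv k g u := by
  induction k with
  | zero => simpa using h
  | succ k ih =>
    intro u hu
    rw [Function.iterate_succ_apply', laguerreD, ih u hu]
    have hd : HasDerivAt (iteratedDeriv k g) (iteratedDeriv (k + 1) g u) u := by
      rw [iteratedDeriv_succ]
      exact (hg.differentiable_iteratedDeriv k
        (by exact_mod_cast WithTop.coe_lt_top k) u).hasDerivAt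
    have h1 : HasDerivAt (fun u : ℝ => u ^ (α + 1 / 2)) ((α + 1 / 2) * u ^ (α + 1 / 2 - 1)) u :=
      Real.hasDerivAt_rpow_const (Or.inl hu.ne')
    have h2 : HasDerivAt (fun u : ℝ => Real.exp (-(u ^ 2 / 2)))
        (Real.exp (-(u ^ 2 / 2)) * -u) u := by
      have : HasDerivAt (fun u : ℝ => -(u ^ 2 / 2)) (-u) u := by
        convert! ((hasDerivAt_pow 2 u).div_const 2).neg using 1
        simp
      exact this.exp
    have h3 := ((h1.mul h2).mul hd).congr_of_eventuallyEq
      (f₁ := (laguerreD α)^[k] f) (by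
        filter_upwards [lt_mem_nhds hu] with w hw using ih w hw)
    rw [h3.deriv, Real.rpow_sub_one hu.ne']
    simp only [Pi.mul_apply]
    field_simp
    ring

theorem hermiteD_iterate_eq {f g : ℝ → ℝ} (hg : ContDiff ℝ ∞ g)
    (h : ∀ u, f u = Real.exp (-(u ^ 2 / 2)) * g u) (k : ℕ) :
    ∀ u, hermiteD^[k] f u = Real.exp (-(u ^ 2 / 2)) * iteratedDeriv k g u := by
  induction k with
  | zero => simpa using h
  | succ k ih =>
    intro u
    have hd : HasDerivAt (iteratedDeriv k g) (iteratedDeriv (k + 1) g u) u := by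
      rw [iteratedDeriv_succ]
      exact (hg.differentiable_iteratedDeriv k
        (by exact_mod_cast WithTop.coe_lt_top k) u).hasDerivAt
    have h2 : HasDerivAt (fun u : ℝ => Real.exp (-(u ^ 2 / 2)))
        (Real.exp (-(u ^ 2 / 2)) * -u) u := by
      have : HasDerivAt (fun u : ℝ => -(u ^ 2 / 2)) (-u) u := by
        convert! ((hasDerivAt_pow 2 u).div_const 2).neg using 1
        simp
      exact this.exp
    have h3 : HasDerivAt (fun u => Real.exp (-(u ^ 2 / 2)) * iteratedDeriv k g u) _ u := h2.mul hd
    rw [Function.iterate_succ_apply', hermiteD, ih u, funext ih, h3.deriv]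
    ring

theorem two_mul_exp_neg_div {t : ℝ} :
    2 * Real.exp (-t) / (1 - Real.exp (-2 * t)) = (Real.sinh t)⁻¹ := by
  rw [Real.sinh_eq, inv_div]
  have h : 1 - Real.exp (-2 * t) = Real.exp (-t) * (Real.exp t - Real.exp (-t)) := by
    rw [mul_sub, ← Real.exp_add, ← Real.exp_add]
    rw [neg_add_cancel, Real.exp_zero]
    ring_nf
  rw [h, mul_comm 2, mul_div_mul_left _ _ (Real.exp_pos _).ne']

theorem one_add_exp_div_one_sub_exp {t : ℝ} :
    (1 + Real.exp (-2 * t)) / (1 - Real.exp (-2 * t)) = Real.cosh t * (Real.sinh t)⁻¹ := by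
  rw [← two_mul_exp_neg_div, Real.cosh_eq, mul_div_assoc']
  congr 1
  rw [show -2 * t = -t + -t by ring, Real.exp_add, Real.exp_neg]
  field_simp

/-- The weight common to the Laguerre and the Hermite kernel. -/
noncomputable def mehlerWeight (x y t : ℝ) : ℝ :=
  Real.exp (-(x ^ 2 / 2) - y ^ 2 / 2 * (Real.cosh t * (Real.sinh t)⁻¹))

/-- coth t = 1 + e^(-t)/sinh t: this splits off the factor e^(-x²/2) needed for the conjugation. -/
theorem exponent_eq (x y t : ℝ) (ht : 0 < t) :
    -(1 / 2) * (x ^ 2 + y ^ 2) * (Real.cosh t * (Real.sinh t)⁻¹) =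
      -(x ^ 2 / 2) - y ^ 2 / 2 * (Real.cosh t * (Real.sinh t)⁻¹) -
        Real.exp (-t) * (Real.sinh t)⁻¹ / 2 * x ^ 2 := by
  have hs : 0 < Real.sinh t := Real.sinh_pos_iff.2 ht
  have h1 : Real.exp (-t) = Real.cosh t - Real.sinh t := (Real.cosh_sub_sinh t).symm
  rw [h1]
  field_simp
  ring

theorem laguerreRieszIntegrand_eq {α : ℝ} {Φ : ℝ → ℝ} (hΦ : IsBesselSymbol α Φ) (k : ℕ)
    {x y t : ℝ} (hx : 0 < x) (hy : 0 < y) (ht : 0 < t) :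
    laguerreRieszIntegrand α k x y t = t ^ ((k : ℝ) / 2 - 1) * ((Real.sinh t)⁻¹ ^ (1 / 2 : ℝ) *
      (x * y * (Real.sinh t)⁻¹) ^ (α + 1 / 2) * mehlerWeight x y t *
      iteratedDeriv k (besselGauss Φ (Real.exp (-t) * (Real.sinh t)⁻¹ / 2)
        (y * (Real.sinh t)⁻¹)) x) := by
  have hs : 0 < Real.sinh t := Real.sinh_pos_iff.2 ht
  set σ := (Real.sinh t)⁻¹ with hσ
  have hσ0 : 0 < σ := inv_pos.2 hs
  set c := σ ^ (1 / 2 : ℝ) * (y * σ) ^ (α + 1 / 2) *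
    Real.exp (-(y ^ 2 / 2 * (Real.cosh t * σ))) with hc
  have hheat : ∀ u, 0 < u → laguerreHeat α t u y = u ^ (α + 1 / 2) * Real.exp (-(u ^ 2 / 2)) *
      (c * besselGauss Φ (Real.exp (-t) * σ / 2) (y * σ) u) := by
    intro u hu
    have hz : 2 * u * y * Real.exp (-t) / (1 - Real.exp (-2 * t)) = y * σ * u := by
      rw [hσ, ← two_mul_exp_neg_div]; ring
    have hzp : 0 < y * σ * u := by positivity
    rw [laguerreHeat, hz, two_mul_exp_neg_div, one_add_exp_div_one_sub_exp, ← hσ,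
      hΦ.besselI_eq hzp, exponent_eq u y t ht, ← hσ, besselGauss, gaussExp, hc]
    have e1 : (y * σ * u) ^ (1 / 2 : ℝ) * (y * σ * u) ^ α =
        (y * σ) ^ (α + 1 / 2) * u ^ (α + 1 / 2) := by
      rw [← Real.mul_rpow (by positivity) hu.le, ← Real.rpow_add hzp, add_comm]
    have e2 : Real.exp (-(u ^ 2 / 2) - y ^ 2 / 2 * (Real.cosh t * σ) -
        Real.exp (-t) * σ / 2 * u ^ 2) * Real.exp (y * σ * u) = Real.exp (-(u ^ 2 / 2)) *
        Real.exp (-(y ^ 2 / 2 * (Real.cosh t * σ))) *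
        Real.exp (y * σ * u - Real.exp (-t) * σ / 2 * u ^ 2) := by
      rw [← Real.exp_add, ← Real.exp_add, ← Real.exp_add]
      ring_nf
    linear_combination (σ ^ (1 / 2 : ℝ) * Real.exp (y * σ * u) * Φ (y * σ * u) *
      Real.exp (-(u ^ 2 / 2) - y ^ 2 / 2 * (Real.cosh t * σ) -
        Real.exp (-t) * σ / 2 * u ^ 2)) * e1 +
      σ ^ (1 / 2 : ℝ) * Φ (y * σ * u) * ((y * σ) ^ (α + 1 / 2) * u ^ (α + 1 / 2)) * e2
  rw [laguerreRieszIntegrand, laguerreD_iterate_eq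
    (contDiff_const.mul (contDiff_besselGauss hΦ.symbol.1 _ _)) hheat k x hx,
    iteratedDeriv_const_mul_field, mehlerWeight, ← hσ, sub_eq_add_neg _ (y ^ 2 / 2 * _),
    Real.exp_add, mul_assoc x y σ, Real.mul_rpow hx.le (by positivity)]
  ring

theorem hermiteRieszIntegrand_eq (k : ℕ) {x y t : ℝ} (ht : 0 < t) :
    hermiteRieszIntegrand k x y t = t ^ ((k : ℝ) / 2 - 1) * (1 / √(2 * Real.pi) *
      (Real.sinh t)⁻¹ ^ (1 / 2 : ℝ) * mehlerWeight x y t *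
      iteratedDeriv k (gaussExp (Real.exp (-t) * (Real.sinh t)⁻¹ / 2)
        (y * (Real.sinh t)⁻¹)) x) := by
  have hs : 0 < Real.sinh t := Real.sinh_pos_iff.2 ht
  set σ := (Real.sinh t)⁻¹ with hσ
  have hσ0 : 0 < σ := inv_pos.2 hs
  set c := 1 / √(2 * Real.pi) * σ ^ (1 / 2 : ℝ) *
    Real.exp (-(y ^ 2 / 2 * (Real.cosh t * σ))) with hc
  have hheat : ∀ u, hermiteHeat t u y = Real.exp (-(u ^ 2 / 2)) *
      (c * gaussExp (Real.exp (-t) * σ / 2) (y * σ) u) := by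
    intro u
    have hz : 2 * u * y * Real.exp (-t) / (1 - Real.exp (-2 * t)) = y * σ * u := by
      rw [hσ, ← two_mul_exp_neg_div]; ring
    have hq : Real.exp (-t) / (1 - Real.exp (-2 * t)) = σ / 2 := by
      rw [hσ, ← two_mul_exp_neg_div]; ring
    rw [gaussExp, hermiteHeat, hz, hq, one_add_exp_div_one_sub_exp, ← hσ, exponent_eq u y t ht, ← hσ, hc,
      Real.div_rpow hσ0.le (by norm_num), ← Real.sqrt_eq_rpow 2, Real.sqrt_mul (by norm_num)]
    have e2 : Real.exp (-(u ^ 2 / 2) - y ^ 2 / 2 * (Real.cosh t * σ) -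
        Real.exp (-t) * σ / 2 * u ^ 2 + y * σ * u) = Real.exp (-(u ^ 2 / 2)) *
        Real.exp (-(y ^ 2 / 2 * (Real.cosh t * σ))) *
        Real.exp (y * σ * u - Real.exp (-t) * σ / 2 * u ^ 2) := by
      rw [← Real.exp_add, ← Real.exp_add]
      ring_nf
    rw [e2]
    ring
  rw [hermiteRieszIntegrand, hermiteD_iterate_eq (contDiff_const.mul (contDiff_gaussExp _ _)) hheat k x,
    iteratedDeriv_const_mul_field, mehlerWeight, ← hσ, sub_eq_add_neg _ (y ^ 2 / 2 * _),
    Real.exp_add]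
  ring

/-! ### Gaussian decay and model integrals in t. -/

theorem sinh_le_mul_cosh {t : ℝ} (ht : 0 ≤ t) : Real.sinh t ≤ t * Real.cosh t := by
  have hd : ∀ t : ℝ, HasDerivAt (fun t => t * Real.cosh t - Real.sinh t) (t * Real.sinh t) t := by
    intro t
    convert! ((hasDerivAt_id t).mul (Real.hasDerivAt_cosh t)).sub (Real.hasDerivAt_sinh t) using 1
    simp
  have hm : MonotoneOn (fun t => t * Real.cosh t - Real.sinh t) (Ici 0) := by
    refine monotoneOn_of_deriv_nonneg (convex_Ici 0)
      (fun t _ => (hd t).continuousAt.continuousWithinAt)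
      (fun t _ => (hd t).differentiableAt.differentiableWithinAt) fun t ht => ?_
    rw [interior_Ici] at ht
    rw [(hd t).deriv]
    exact mul_nonneg (le_of_lt ht) (Real.sinh_nonneg_iff.2 (le_of_lt ht))
  have := hm self_mem_Ici ht ht
  simp at this
  linarith

/-- The exponent is at most -(x-y)² coth(t)/4, and coth t ≥ 1/t. For the first bound, after
multiplication by 8 sinh t the surplus is x² e^t + y² e^(-t) + 4xy cosh t - 6xy, nonnegative since
the first two terms dominate 2xy and cosh t ≥ 1. -/
theorem mehlerWeight_mul_exp_le {x y t : ℝ} (hx : 0 < x) (hy : 0 < y) (ht : 0 < t) :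
    mehlerWeight x y t * Real.exp (3 / 4 * (y * (Real.sinh t)⁻¹ * x -
        Real.exp (-t) * (Real.sinh t)⁻¹ / 2 * x ^ 2) +
        (y * (Real.sinh t)⁻¹) ^ 2 / (16 * (Real.exp (-t) * (Real.sinh t)⁻¹ / 2))) ≤
      Real.exp (-((x - y) ^ 2 / (4 * t))) := by
  have hs : 0 < Real.sinh t := Real.sinh_pos_iff.2 ht
  rw [mehlerWeight, ← Real.exp_add, Real.exp_le_exp]
  have hsc := sinh_le_mul_cosh ht.le
  have hexp : Real.exp t * Real.exp (-t) = 1 := by rw [← Real.exp_add]; simp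
  have hch := Real.cosh_eq t
  have hsh := Real.sinh_eq t
  have hE := Real.exp_pos t
  have hF := Real.exp_pos (-t)
  set E := Real.exp t
  set F := Real.exp (-t)
  have hFE : F = E⁻¹ := by field_simp; linarith
  have h1 : (y * (Real.sinh t)⁻¹) ^ 2 / (16 * (F * (Real.sinh t)⁻¹ / 2)) =
      y ^ 2 * E * (Real.sinh t)⁻¹ / 8 := by
    rw [hFE]; field_simp; norm_num
  rw [h1]
  have h2 : -((x - y) ^ 2 * Real.cosh t / 4) * (Real.sinh t)⁻¹ ≤ -((x - y) ^ 2 / (4 * t)) := by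
    rw [neg_mul, neg_le_neg_iff, ← div_eq_mul_inv, div_div, div_le_div_iff₀ (by positivity)
      (by positivity)]
    nlinarith [mul_le_mul_of_nonneg_left hsc (sq_nonneg (x - y))]
  refine le_trans ?_ h2
  have h3 : -(x ^ 2 / 2) = -(x ^ 2 / 2) * Real.sinh t * (Real.sinh t)⁻¹ := by field_simp
  rw [h3]
  have h4 : -(x ^ 2 / 2) * Real.sinh t - y ^ 2 / 2 * Real.cosh t +
      (3 / 4 * (y * x - F / 2 * x ^ 2) + y ^ 2 * E / 8) ≤ -((x - y) ^ 2 * Real.cosh t / 4) := by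
    rw [hch, hsh]
    have hxy : 0 < x * y := by positivity
    have hEF : 2 ≤ E + F := by nlinarith [sq_nonneg (E - F)]
    have h5 : 2 * (x * y) ≤ x ^ 2 * E + y ^ 2 * F := by
      have : 0 ≤ F * (x * E - y) ^ 2 := by positivity
      have e : F * (x * E - y) ^ 2 = x ^ 2 * E * (E * F) - 2 * (x * y) * (E * F) + y ^ 2 * F := by
        ring
      rw [e, hexp] at this
      linarith
    nlinarith [mul_le_mul_of_nonneg_left hEF hxy.le]
  have h6 := mul_le_mul_of_nonneg_right h4 (inv_pos.2 hs).le
  refine le_trans (le_of_eq ?_) h6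
  ring

/-- The substitution t ↦ 1/t turns this into a Gamma integral. -/
theorem integrableOn_rpow_mul_exp_neg_div {γ B : ℝ} (hγ : 0 < γ) (hB : 0 < B) :
    IntegrableOn (fun t : ℝ => t ^ (-γ - 1) * Real.exp (-(B / t))) (Ioi 0) ∧
      ∫ t in Ioi (0 : ℝ), t ^ (-γ - 1) * Real.exp (-(B / t)) = Real.Gamma γ * B ^ (-γ) := by
  set g : ℝ → ℝ := fun u => u ^ (γ - 1) * Real.exp (-(B * u)) with hg
  have hcong : ∀ t ∈ Ioi (0 : ℝ), (|(-1 : ℝ)| * t ^ ((-1 : ℝ) - 1)) • g (t ^ (-1 : ℝ)) =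
      t ^ (-γ - 1) * Real.exp (-(B / t)) := by
    intro t ht
    have ht0 : (0 : ℝ) < t := ht
    rw [hg, smul_eq_mul, abs_neg, abs_one, one_mul]
    simp only
    rw [← Real.rpow_mul ht0.le, ← mul_assoc, ← Real.rpow_add ht0, Real.rpow_neg_one]
    ring_nf
  have hint := integrableOn_rpow_mul_exp_neg_mul (a := γ - 1) (by linarith) hB
  have hval := integral_rpow_mul_exp_neg_mul (a := γ - 1) (by linarith) hB
  rw [sub_add_cancel] at hval
  refine ⟨?_, ?_⟩
  · have := (integrableOn_Ioi_comp_rpow_iff g (p := -1) (by norm_num)).2 hint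
    exact this.congr_fun hcong measurableSet_Ioi
  · rw [← setIntegral_congr_fun measurableSet_Ioi hcong,
      integral_comp_rpow_Ioi g (by norm_num), hval]

theorem integrableOn_and_abs_integral_le_of_abs_le {f : ℝ → ℝ} {γ B K : ℝ} (hγ : 0 < γ)
    (hB : 0 < B) (hf : AEStronglyMeasurable f (volume.restrict (Ioi 0)))
    (h : ∀ t, 0 < t → |f t| ≤ K * (t ^ (-γ - 1) * Real.exp (-(B / t)))) :
    IntegrableOn f (Ioi 0) ∧ |∫ t in Ioi (0 : ℝ), f t| ≤ K * (Real.Gamma γ * B ^ (-γ)) := by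
  obtain ⟨hi, hv⟩ := integrableOn_rpow_mul_exp_neg_div hγ hB
  have hae : ∀ᵐ t ∂(volume.restrict (Ioi (0 : ℝ))),
      ‖f t‖ ≤ K * (t ^ (-γ - 1) * Real.exp (-(B / t))) :=
    (ae_restrict_iff' measurableSet_Ioi).2 (Eventually.of_forall h)
  refine ⟨Integrable.mono' (hi.const_mul K) hf hae, ?_⟩
  rw [← Real.norm_eq_abs, ← hv, ← integral_const_mul]
  exact norm_integral_le_of_norm_le (hi.const_mul K) hae

/-- Because 1/t ≤ coth t, the integrand is dominated by cosh t (sinh t)^(-γ-1), which has an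
explicit primitive. -/
theorem integrableOn_inv_mul_sinh_rpow {γ t₀ : ℝ} (hγ : 0 < γ) (ht₀ : 0 < t₀) :
    IntegrableOn (fun t : ℝ => t⁻¹ * (Real.sinh t)⁻¹ ^ γ) (Ioi t₀) ∧
      ∫ t in Ioi t₀, t⁻¹ * (Real.sinh t)⁻¹ ^ γ ≤ γ⁻¹ * Real.sinh t₀ ^ (-γ) := by
  have hpos : ∀ t ∈ Ici t₀, 0 < Real.sinh t := fun t ht =>
    Real.sinh_pos_iff.2 (ht₀.trans_le ht)
  have hd : ∀ t ∈ Ici t₀, HasDerivAt (fun t => -γ⁻¹ * Real.sinh t ^ (-γ))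
      (Real.sinh t ^ (-γ - 1) * Real.cosh t) t := by
    intro t ht
    convert! ((Real.hasDerivAt_sinh t).rpow_const (p := -γ)
      (Or.inl (hpos t ht).ne')).const_mul (-γ⁻¹) using 1
    field_simp
  have hnn : ∀ t ∈ Ioi t₀, 0 ≤ Real.sinh t ^ (-γ - 1) * Real.cosh t := fun t ht =>
    mul_nonneg (Real.rpow_nonneg (hpos t (mem_Ici.2 (le_of_lt ht))).le _) (Real.cosh_pos t).le
  have hlim : Tendsto (fun t => -γ⁻¹ * Real.sinh t ^ (-γ)) atTop (𝓝 0) := by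
    have hsinh : Tendsto Real.sinh atTop atTop := tendsto_atTop_mono' _
      ((eventually_ge_atTop 0).mono fun t ht => Real.self_le_sinh_iff.2 ht) tendsto_id
    have := ((tendsto_rpow_neg_atTop hγ).comp hsinh).const_mul (-γ⁻¹)
    simpa using this
  have hI := integrableOn_Ioi_deriv_of_nonneg' hd hnn hlim
  have hV := integral_Ioi_of_hasDerivAt_of_nonneg' hd hnn hlim
  have hle : ∀ t ∈ Ioi t₀, t⁻¹ * (Real.sinh t)⁻¹ ^ γ ≤
      Real.sinh t ^ (-γ - 1) * Real.cosh t := by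
    intro t ht
    have ht0 : 0 < t := ht₀.trans ht
    have hs := hpos t (mem_Ici.2 (le_of_lt ht))
    rw [Real.inv_rpow hs.le, ← Real.rpow_neg hs.le, Real.rpow_sub_one hs.ne', mul_comm,
      div_mul_eq_mul_div, mul_div_assoc]
    gcongr
    rw [le_div_iff₀ hs, inv_mul_le_iff₀ ht0]
    exact sinh_le_mul_cosh ht0.le
  have hi : IntegrableOn (fun t : ℝ => t⁻¹ * (Real.sinh t)⁻¹ ^ γ) (Ioi t₀) := by
    refine Integrable.mono' hI ?_ ?_
    · exact (measurable_inv.mul (Real.measurable_sinh.inv.pow_const γ)).aestronglyMeasurable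
    · refine (ae_restrict_iff' measurableSet_Ioi).2 (Eventually.of_forall fun t ht => ?_)
      have ht0 : 0 < t := ht₀.trans ht
      have hs := hpos t (mem_Ici.2 (le_of_lt ht))
      rw [Real.norm_eq_abs, abs_of_nonneg (by positivity)]
      exact hle t ht
  refine ⟨hi, (setIntegral_mono_on hi hI measurableSet_Ioi hle).trans_eq ?_⟩
  rw [hV]
  ring

theorem rpow_half_sub_one {t : ℝ} (ht : 0 < t) (k : ℕ) :
    t ^ ((k : ℝ) / 2 - 1) = √t ^ k * t⁻¹ := by
  rw [Real.rpow_sub_one ht.ne', Real.sqrt_eq_rpow, ← Real.rpow_natCast, ← Real.rpow_mul ht.le,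
    div_eq_mul_inv]
  ring_nf

/-! ### The common Riesz integrand and its pointwise bounds. -/

/-- The integrand of the Riesz kernel attached to a symbol `Φ`: it specializes to the Laguerre and
to the Hermite integrand. -/
noncomputable def rieszIntegrand (α : ℝ) (Φ : ℝ → ℝ) (k : ℕ) (x y t : ℝ) : ℝ :=
  t ^ ((k : ℝ) / 2 - 1) * ((Real.sinh t)⁻¹ ^ (1 / 2 : ℝ) *
    (x * y * (Real.sinh t)⁻¹) ^ (α + 1 / 2) * mehlerWeight x y t *
    iteratedDeriv k (besselGauss Φ (Real.exp (-t) * (Real.sinh t)⁻¹ / 2)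
      (y * (Real.sinh t)⁻¹)) x)

/-- The majorant of `rieszIntegrand`. -/
noncomputable def rieszMajorant (α : ℝ) (n : ℕ) (x y t : ℝ) : ℝ :=
  t ^ ((n : ℝ) / 2 - 1) * ((Real.sinh t)⁻¹ ^ (1 / 2 : ℝ) *
    (x * y * (Real.sinh t)⁻¹) ^ (α + 1 / 2)) * ((1 + x * y * (Real.sinh t)⁻¹) *
    (y * (Real.sinh t)⁻¹ + √(Real.sinh t)⁻¹) ^ n * Real.exp (-((x - y) ^ 2 / (4 * t))))

theorem hermiteRieszIntegrand_eq_rieszIntegrand (k : ℕ) {x y t : ℝ} (ht : 0 < t) :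
    hermiteRieszIntegrand k x y t =
      1 / √(2 * Real.pi) * rieszIntegrand (-1 / 2) (fun _ => 1) k x y t := by
  have : besselGauss (fun _ => 1) (Real.exp (-t) * (Real.sinh t)⁻¹ / 2) (y * (Real.sinh t)⁻¹) =
      gaussExp (Real.exp (-t) * (Real.sinh t)⁻¹ / 2) (y * (Real.sinh t)⁻¹) :=
    funext fun u => one_mul _
  rw [hermiteRieszIntegrand_eq k ht, rieszIntegrand, this, show (-1 / 2 + 1 / 2 : ℝ) = 0 by ring,
    Real.rpow_zero]
  ring

theorem isSymbol_one : IsSymbol 0 (fun _ => 1) := by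
  refine ⟨contDiff_const, fun j => ⟨1, zero_le_one, fun z hz => ?_⟩⟩
  rw [iteratedDeriv_const]
  have h1 : (0 : ℝ) < 1 + z := by linarith
  split_ifs with h
  · simp [h]
  · rw [abs_zero]; positivity

/-- The derivative in x of a function depending on t is not visibly measurable in t; the Leibniz and
Hermite formulas give an explicit expression that is. -/
theorem aestronglyMeasurable_rieszIntegrand {α : ℝ} {Φ : ℝ → ℝ} (hΦ : ContDiff ℝ ∞ Φ) (k : ℕ)
    (x y : ℝ) :
    AEStronglyMeasurable (rieszIntegrand α Φ k x y) (volume.restrict (Ioi 0)) := by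
  have hm : Measurable fun t : ℝ => t ^ ((k : ℝ) / 2 - 1) * ((Real.sinh t)⁻¹ ^ (1 / 2 : ℝ) *
      (x * y * (Real.sinh t)⁻¹) ^ (α + 1 / 2) * mehlerWeight x y t *
      ∑ i ∈ Finset.range (k + 1), k.choose i * ((y * (Real.sinh t)⁻¹) ^ i *
        iteratedDeriv i Φ (y * (Real.sinh t)⁻¹ * x)) *
        ((-√(2 * (Real.exp (-t) * (Real.sinh t)⁻¹ / 2))) ^ (k - i) *
        Polynomial.aeval (√(2 * (Real.exp (-t) * (Real.sinh t)⁻¹ / 2)) * x -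
          y * (Real.sinh t)⁻¹ / √(2 * (Real.exp (-t) * (Real.sinh t)⁻¹ / 2)))
          (Polynomial.hermite (k - i)) *
        Real.exp (y * (Real.sinh t)⁻¹ * x - Real.exp (-t) * (Real.sinh t)⁻¹ / 2 * x ^ 2))) := by
    have hsi : Measurable fun t : ℝ => (Real.sinh t)⁻¹ := Real.measurable_sinh.inv
    have hD : ∀ i, Measurable (iteratedDeriv i Φ) := fun i =>
      (hΦ.continuous_iteratedDeriv i (by exact_mod_cast le_top)).measurable
    have hP : ∀ i, Measurable fun v : ℝ => Polynomial.aeval v (Polynomial.hermite i) := fun i =>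
      (Polynomial.continuous_aeval _).measurable
    have hM : Measurable fun t => mehlerWeight x y t := by
      unfold mehlerWeight
      have := Real.measurable_cosh
      fun_prop
    have hS : Measurable fun t : ℝ => √(2 * (Real.exp (-t) * (Real.sinh t)⁻¹ / 2)) := by fun_prop
    refine Measurable.mul (by fun_prop) (Measurable.mul (by fun_prop) ?_)
    refine Finset.measurable_sum _ fun i _ => ?_
    have h1 : Measurable fun t : ℝ => iteratedDeriv i Φ (y * (Real.sinh t)⁻¹ * x) :=
      (hD i).comp (by fun_prop)
    have h2 : Measurable fun t : ℝ =>
        Polynomial.aeval (√(2 * (Real.exp (-t) * (Real.sinh t)⁻¹ / 2)) * x -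
          y * (Real.sinh t)⁻¹ / √(2 * (Real.exp (-t) * (Real.sinh t)⁻¹ / 2)))
          (Polynomial.hermite (k - i)) := (hP (k - i)).comp (by fun_prop)
    fun_prop
  refine hm.aestronglyMeasurable.congr ?_
  refine (ae_restrict_iff' measurableSet_Ioi).2 (Eventually.of_forall fun t ht => ?_)
  have hs : 0 < Real.sinh t := Real.sinh_pos_iff.2 ht
  rw [rieszIntegrand, iteratedDeriv_besselGauss hΦ]
  have ha : 0 < Real.exp (-t) * (Real.sinh t)⁻¹ / 2 := by positivity
  unfold gaussExp
  simp only [iteratedDeriv_exp_mul_sub_sq ha]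

/-- The derivative is taken at `u` but the weight at `x`, as the mean value argument for odd k
requires. For x ≤ y, bu - au² increases on [0,x] because 2a ≤ σ gives 2ax ≤ σy, so the case u = x is
the worst. -/
theorem mehlerWeight_mul_abs_iteratedDeriv_le {Φ : ℝ → ℝ} {ρ : ℝ} (hρ : ρ ≤ 1)
    (hΦ : IsSymbol ρ Φ) (n : ℕ) : ∃ C, 0 ≤ C ∧ ∀ x y t u : ℝ, 0 < x → 0 < y → 0 < t → 0 ≤ u →
      u ≤ x → (u = x ∨ x ≤ y) → mehlerWeight x y t *
        |iteratedDeriv n (besselGauss Φ (Real.exp (-t) * (Real.sinh t)⁻¹ / 2)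
          (y * (Real.sinh t)⁻¹)) u| ≤ C * ((1 + x * y * (Real.sinh t)⁻¹) *
        (y * (Real.sinh t)⁻¹ + √(Real.sinh t)⁻¹) ^ n * Real.exp (-((x - y) ^ 2 / (4 * t)))) := by
  obtain ⟨C, hC, h⟩ := abs_iteratedDeriv_besselGauss_le hρ hΦ n
  refine ⟨C, hC, fun x y t u hx hy ht hu hux hxy => ?_⟩
  have hs : 0 < Real.sinh t := Real.sinh_pos_iff.2 ht
  have hw := mehlerWeight_mul_exp_le hx hy ht
  set σ := (Real.sinh t)⁻¹ with hσ
  have hσ0 : 0 < σ := inv_pos.2 hs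
  set a := Real.exp (-t) * σ / 2 with ha
  have ha0 : 0 < a := by positivity
  have haσ : 2 * a ≤ σ := by
    have : Real.exp (-t) ≤ 1 := Real.exp_le_one_iff.2 (by linarith)
    rw [ha]
    nlinarith
  have hmono : y * σ * u - a * u ^ 2 ≤ y * σ * x - a * x ^ 2 := by
    rcases hxy with rfl | hxy
    · exact le_rfl
    · have h1 : a * (x + u) ≤ y * σ := by
        calc a * (x + u) ≤ a * (x + x) := by gcongr
          _ = 2 * a * x := by ring
          _ ≤ σ * y := by gcongr
          _ = _ := mul_comm _ _
      nlinarith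
  have hM : 0 < mehlerWeight x y t := Real.exp_pos _
  calc _ ≤ mehlerWeight x y t * (C * (1 + y * σ * u) * (y * σ + √(2 * a)) ^ n *
        Real.exp (3 / 4 * (y * σ * u - a * u ^ 2) + (y * σ) ^ 2 / (16 * a))) := by
        gcongr
        exact h a (y * σ) u ha0 (by positivity) hu
    _ ≤ mehlerWeight x y t * (C * (1 + y * σ * x) * (y * σ + √σ) ^ n *
        Real.exp (3 / 4 * (y * σ * x - a * x ^ 2) + (y * σ) ^ 2 / (16 * a))) := by
        gcongr
    _ = C * (1 + y * σ * x) * (y * σ + √σ) ^ n * (mehlerWeight x y t *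
        Real.exp (3 / 4 * (y * σ * x - a * x ^ 2) + (y * σ) ^ 2 / (16 * a))) := by ring
    _ ≤ C * (1 + y * σ * x) * (y * σ + √σ) ^ n * Real.exp (-((x - y) ^ 2 / (4 * t))) := by
        gcongr
    _ = _ := by ring

theorem abs_rieszIntegrand_le {α : ℝ} {Φ : ℝ → ℝ} {ρ : ℝ} (hρ : ρ ≤ 1)
    (hΦ : IsSymbol ρ Φ) (n : ℕ) : ∃ C, 0 ≤ C ∧ ∀ x y t : ℝ, 0 < x → 0 < y → 0 < t →
      |rieszIntegrand α Φ n x y t| ≤ C * rieszMajorant α n x y t := by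
  obtain ⟨C, hC, h⟩ := mehlerWeight_mul_abs_iteratedDeriv_le hρ hΦ n
  refine ⟨C, hC, fun x y t hx hy ht => ?_⟩
  have hs : 0 < Real.sinh t := Real.sinh_pos_iff.2 ht
  have := h x y t x hx hy ht hx.le le_rfl (Or.inl rfl)
  have hM : 0 < mehlerWeight x y t := Real.exp_pos _
  rw [rieszIntegrand, rieszMajorant, abs_mul, abs_mul, abs_mul, abs_of_pos (by positivity),
    abs_of_pos (by positivity), abs_of_pos hM]
  set G := |iteratedDeriv n (besselGauss Φ (Real.exp (-t) * (Real.sinh t)⁻¹ / 2)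
          (y * (Real.sinh t)⁻¹)) x|
  calc _ = t ^ ((n : ℝ) / 2 - 1) * ((Real.sinh t)⁻¹ ^ (1 / 2 : ℝ) *
        (x * y * (Real.sinh t)⁻¹) ^ (α + 1 / 2)) * (mehlerWeight x y t * G) := by ring
    _ ≤ _ := mul_le_mul_of_nonneg_left this (by positivity)
    _ = _ := by ring

theorem iteratedDeriv_odd_eq_zero {f : ℝ → ℝ} (hf : ∀ u, f (-u) = f u) {k : ℕ} (hk : Odd k) :
    iteratedDeriv k f 0 = 0 := by
  have h := iteratedDeriv_comp_neg k f 0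
  rw [funext hf, hk.neg_one_pow, neg_zero, neg_smul, one_smul] at h
  linarith

/-- An odd derivative of an even function vanishes at 0, so the mean value theorem trades it for x
times one more derivative. The factor t^(-1/2) corrects the power of t in the majorant of order k +
1. -/
theorem abs_rieszIntegrand_le_of_odd {α : ℝ} {Φ : ℝ → ℝ} {ρ : ℝ} (hρ : ρ ≤ 1)
    (hΦ : IsSymbol ρ Φ) (heven : ∀ z, Real.exp (-z) * Φ (-z) = Real.exp z * Φ z) {k : ℕ}
    (hk : Odd k) : ∃ C, 0 ≤ C ∧ ∀ x y t : ℝ, 0 < x → x ≤ y → 0 < t →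
      |rieszIntegrand α Φ k x y t| ≤
        C * (x * (t ^ (-(1 / 2) : ℝ) * rieszMajorant α (k + 1) x y t)) := by
  obtain ⟨C, hC, h⟩ := mehlerWeight_mul_abs_iteratedDeriv_le hρ hΦ (k + 1)
  refine ⟨C, hC, fun x y t hx hxy ht => ?_⟩
  have hy : 0 < y := hx.trans_le hxy
  have hs : 0 < Real.sinh t := Real.sinh_pos_iff.2 ht
  have hM : 0 < mehlerWeight x y t := Real.exp_pos _
  rw [rieszIntegrand, rieszMajorant, abs_mul, abs_mul, abs_mul, abs_of_pos (by positivity),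
    abs_of_pos (by positivity), abs_of_pos hM]
  set σ := (Real.sinh t)⁻¹
  set g := besselGauss Φ (Real.exp (-t) * σ / 2) (y * σ) with hg
  have hgs : ContDiff ℝ ∞ g := contDiff_besselGauss hΦ.1 _ _
  have hgeven : ∀ u, g (-u) = g u := by
    intro u
    have := heven (y * σ * u)
    simp only [hg, besselGauss, gaussExp]
    rw [mul_neg, neg_sq, sub_eq_add_neg, sub_eq_add_neg, Real.exp_add, Real.exp_add]
    linear_combination Real.exp (-(Real.exp (-t) * σ / 2 * u ^ 2)) * this
  have hg0 := iteratedDeriv_odd_eq_zero hgeven hk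
  set E := (1 + x * y * σ) * (y * σ + √σ) ^ (k + 1) * Real.exp (-((x - y) ^ 2 / (4 * t))) with hE
  have hd : Differentiable ℝ (iteratedDeriv k g) :=
    hgs.differentiable_iteratedDeriv k (by exact_mod_cast WithTop.coe_lt_top k)
  have hmv : |iteratedDeriv k g x| ≤ C * E / mehlerWeight x y t * x := by
    have := (convex_Icc (0 : ℝ) x).norm_image_sub_le_of_norm_deriv_le (f := iteratedDeriv k g)
      (C := C * E / mehlerWeight x y t) (x := 0) (y := x) (fun u _ => hd u) (fun u hu => by
        rw [← iteratedDeriv_succ, Real.norm_eq_abs, le_div_iff₀ hM, mul_comm]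
        exact h x y t u hx hy ht hu.1 hu.2 (Or.inr hxy))
      (left_mem_Icc.2 hx.le) (right_mem_Icc.2 hx.le)
    rwa [hg0, sub_zero, sub_zero, Real.norm_eq_abs, Real.norm_eq_abs, abs_of_pos hx] at this
  have hmv2 : mehlerWeight x y t * |iteratedDeriv k g x| ≤ C * E * x := by
    calc _ ≤ mehlerWeight x y t * (C * E / mehlerWeight x y t * x) := by gcongr
      _ = _ := by field_simp
  have ht2 : t ^ ((k : ℝ) / 2 - 1) =
      t ^ (-(1 / 2) : ℝ) * t ^ (((k + 1 : ℕ) : ℝ) / 2 - 1) := by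
    rw [← Real.rpow_add ht]
    push_cast
    ring_nf
  calc _ = t ^ ((k : ℝ) / 2 - 1) * (σ ^ (1 / 2 : ℝ) *
        (x * y * σ) ^ (α + 1 / 2)) * (mehlerWeight x y t * |iteratedDeriv k g x|) := by ring
    _ ≤ t ^ ((k : ℝ) / 2 - 1) * (σ ^ (1 / 2 : ℝ) *
        (x * y * σ) ^ (α + 1 / 2)) * (C * E * x) := by gcongr
    _ = _ := by
        rw [ht2]
        ring

/-! ### Off-diagonal integrals. -/

theorem inv_sinh_le_inv {t : ℝ} (ht : 0 < t) : (Real.sinh t)⁻¹ ≤ t⁻¹ :=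
  inv_anti₀ ht (Real.self_le_sinh_iff.2 ht.le)

theorem sqrt_mul_sqrt_inv_sinh_le_one {t : ℝ} (ht : 0 < t) : √t * √(Real.sinh t)⁻¹ ≤ 1 := by
  rw [← Real.sqrt_mul ht.le, Real.sqrt_le_one]
  calc t * (Real.sinh t)⁻¹ ≤ t * t⁻¹ := by
        gcongr
        exact Real.self_le_sinh_iff.2 ht.le
    _ = 1 := mul_inv_cancel₀ ht.ne'

theorem rpow_half_mul_rpow {α x y σ : ℝ} (hx : 0 < x) (hy : 0 < y) (hσ : 0 < σ) :
    σ ^ (1 / 2 : ℝ) * (x * y * σ) ^ (α + 1 / 2) = (x * y) ^ (α + 1 / 2) * σ ^ (α + 1) := by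
  rw [Real.mul_rpow (by positivity) hσ.le, show α + 1 = 1 / 2 + (α + 1 / 2) by ring,
    Real.rpow_add hσ (1 / 2)]
  ring

/-- Since tσ ≤ 1, all remaining factors are polynomial in w = √((x²+y²)/t). The Gaussian is at most
e^(-κw²/4): half of it absorbs the polynomial and half is kept. -/
theorem rieszMajorant_le {α κ : ℝ} (hα : -1 < α) (hκ : 0 < κ) (n : ℕ) :
    ∃ C, 0 ≤ C ∧ ∀ x y t : ℝ, 0 < x → 0 < y → 0 < t → κ * (x ^ 2 + y ^ 2) ≤ (x - y) ^ 2 →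
      rieszMajorant α n x y t ≤ C * ((x * y) ^ (α + 1 / 2) *
        (t ^ (-(α + 1) - 1) * Real.exp (-(κ * (x ^ 2 + y ^ 2) / 8 / t)))) := by
  obtain ⟨C, hC, h⟩ := Polynomial.abs_eval_le_mul_exp_sq (ε := κ / 8) (by positivity)
    ((1 + Polynomial.X ^ 2) * (1 + Polynomial.X) ^ n)
  refine ⟨C, hC, fun x y t hx hy ht hxy => ?_⟩
  have hs : 0 < Real.sinh t := Real.sinh_pos_iff.2 ht
  have hσt := inv_sinh_le_inv ht
  have hts := sqrt_mul_sqrt_inv_sinh_le_one ht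
  rw [rieszMajorant, rpow_half_sub_one ht]
  set σ := (Real.sinh t)⁻¹
  have hσ0 : 0 < σ := inv_pos.2 hs
  have hτ : 0 < √t := Real.sqrt_pos.2 ht
  have hτ2 : √t ^ 2 = t := Real.sq_sqrt ht.le
  set w := √(x ^ 2 + y ^ 2) / √t with hw
  have hw0 : 0 ≤ w := by positivity
  have hw2 : w ^ 2 = (x ^ 2 + y ^ 2) / t := by
    rw [hw, div_pow, Real.sq_sqrt (by positivity), hτ2]
  have hσα : σ ^ (α + 1) ≤ t ^ (-(α + 1)) := by
    rw [Real.rpow_neg ht.le, ← Real.inv_rpow ht.le]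
    exact Real.rpow_le_rpow hσ0.le hσt (by linarith)
  have hz : x * y * σ ≤ w ^ 2 := by
    rw [hw2, div_eq_mul_inv]
    gcongr
    nlinarith [sq_nonneg (x - y)]
  have hb : √t * (y * σ + √σ) ≤ 1 + w := by
    have : √t * (y * σ) ≤ w := by
      rw [hw, le_div_iff₀ hτ]
      have h1 : y ≤ √(x ^ 2 + y ^ 2) := Real.le_sqrt_of_sq_le (by nlinarith)
      have h2 : t * σ ≤ 1 := by
        calc t * σ ≤ t * t⁻¹ := by gcongr
          _ = 1 := mul_inv_cancel₀ ht.ne'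
      calc √t * (y * σ) * √t = y * (√t ^ 2 * σ) := by ring
        _ = y * (t * σ) := by rw [hτ2]
        _ ≤ y * 1 := by gcongr
        _ ≤ _ := by linarith
    linarith
  have hpoly : (1 + w ^ 2) * (1 + w) ^ n ≤ C * Real.exp (κ / 8 * w ^ 2) := by
    have := h w
    simp only [Polynomial.eval_mul, Polynomial.eval_add, Polynomial.eval_one,
      Polynomial.eval_pow, Polynomial.eval_X] at this
    exact (le_abs_self _).trans this
  have hexp : Real.exp (κ / 8 * w ^ 2) * Real.exp (-((x - y) ^ 2 / (4 * t))) ≤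
      Real.exp (-(κ * (x ^ 2 + y ^ 2) / 8 / t)) := by
    rw [← Real.exp_add, Real.exp_le_exp, hw2]
    have : κ * (x ^ 2 + y ^ 2) / (4 * t) ≤ (x - y) ^ 2 / (4 * t) := by gcongr
    have e : κ / 8 * ((x ^ 2 + y ^ 2) / t) + κ * (x ^ 2 + y ^ 2) / 8 / t =
      κ * (x ^ 2 + y ^ 2) / (4 * t) := by
      field_simp
      ring
    linarith
  rw [rpow_half_mul_rpow hx hy hσ0]
  calc _ = (x * y) ^ (α + 1 / 2) * σ ^ (α + 1) * t⁻¹ * ((1 + x * y * σ) *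
        (√t * (y * σ + √σ)) ^ n * Real.exp (-((x - y) ^ 2 / (4 * t)))) := by
        rw [mul_pow]
        ring
    _ ≤ (x * y) ^ (α + 1 / 2) * t ^ (-(α + 1)) * t⁻¹ * ((1 + w ^ 2) *
        (1 + w) ^ n * Real.exp (-((x - y) ^ 2 / (4 * t)))) := by gcongr
    _ ≤ (x * y) ^ (α + 1 / 2) * t ^ (-(α + 1)) * t⁻¹ * (C * Real.exp (κ / 8 * w ^ 2) *
        Real.exp (-((x - y) ^ 2 / (4 * t)))) := by gcongr
    _ = C * ((x * y) ^ (α + 1 / 2) * (t ^ (-(α + 1)) * t⁻¹ * (Real.exp (κ / 8 * w ^ 2) *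
        Real.exp (-((x - y) ^ 2 / (4 * t)))))) := by ring
    _ ≤ C * ((x * y) ^ (α + 1 / 2) * (t ^ (-(α + 1)) * t⁻¹ *
        Real.exp (-(κ * (x ^ 2 + y ^ 2) / 8 / t)))) := by gcongr
    _ = _ := by rw [Real.rpow_sub_one ht.ne', div_eq_mul_inv (t ^ (-(α + 1))) t]

theorem exists_abs_integral_rieszIntegrand_le {α κ ρ : ℝ} (hα : -1 < α) (hκ : 0 < κ)
    {Φ : ℝ → ℝ} (hρ : ρ ≤ 1) (hΦ : IsSymbol ρ Φ) (k : ℕ) :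
    ∃ C, 0 ≤ C ∧ ∀ x y : ℝ, 0 < x → 0 < y → κ * (x ^ 2 + y ^ 2) ≤ (x - y) ^ 2 →
      IntegrableOn (rieszIntegrand α Φ k x y) (Ioi 0) ∧
      |∫ t in Ioi (0 : ℝ), rieszIntegrand α Φ k x y t| ≤
        C * ((x * y) ^ (α + 1 / 2) * (x ^ 2 + y ^ 2) ^ (-(α + 1))) := by
  obtain ⟨C, hC, h⟩ := abs_rieszIntegrand_le (α := α) hρ hΦ k
  obtain ⟨C', hC', h'⟩ := rieszMajorant_le hα hκ k
  have hG : 0 < Real.Gamma (α + 1) := Real.Gamma_pos_of_pos (by linarith)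
  refine ⟨(C * C') * (Real.Gamma (α + 1) * (κ / 8) ^ (-(α + 1))), by positivity,
    fun x y hx hy hxy => ?_⟩
  have hX : 0 < x ^ 2 + y ^ 2 := by positivity
  have key := integrableOn_and_abs_integral_le_of_abs_le (γ := α + 1)
    (B := κ * (x ^ 2 + y ^ 2) / 8) (K := (C * C') * (x * y) ^ (α + 1 / 2))
    (f := rieszIntegrand α Φ k x y) (by linarith)
    (by positivity) (aestronglyMeasurable_rieszIntegrand hΦ.1 k x y) (fun t ht => by
      refine (h x y t hx hy ht).trans ?_
      refine (mul_le_mul_of_nonneg_left (h' x y t hx hy ht hxy) hC).trans ?_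
      exact le_of_eq (by ring))
  refine ⟨key.1, key.2.trans_eq ?_⟩
  rw [show κ * (x ^ 2 + y ^ 2) / 8 = κ / 8 * (x ^ 2 + y ^ 2) by ring,
    Real.mul_rpow (by positivity) hX.le]
  ring

theorem exists_abs_integral_rieszIntegrand_le_of_odd {α κ ρ : ℝ} (hα : -1 < α) (hκ : 0 < κ)
    {Φ : ℝ → ℝ} (hρ : ρ ≤ 1) (hΦ : IsSymbol ρ Φ)
    (heven : ∀ z, Real.exp (-z) * Φ (-z) = Real.exp z * Φ z) {k : ℕ} (hk : Odd k) :
    ∃ C, 0 ≤ C ∧ ∀ x y : ℝ, 0 < x → x ≤ y → κ * (x ^ 2 + y ^ 2) ≤ (x - y) ^ 2 →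
      |∫ t in Ioi (0 : ℝ), rieszIntegrand α Φ k x y t| ≤
        C * (x * (x * y) ^ (α + 1 / 2) * (x ^ 2 + y ^ 2) ^ (-(α + 3 / 2))) := by
  obtain ⟨C, hC, h⟩ := abs_rieszIntegrand_le_of_odd (α := α) hρ hΦ heven hk
  obtain ⟨C', hC', h'⟩ := rieszMajorant_le hα hκ (k + 1)
  have hG : 0 < Real.Gamma (α + 3 / 2) := Real.Gamma_pos_of_pos (by linarith)
  refine ⟨(C * C') * (Real.Gamma (α + 3 / 2) * (κ / 8) ^ (-(α + 3 / 2))), by positivity,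
    fun x y hx hxy hκxy => ?_⟩
  have hy : 0 < y := hx.trans_le hxy
  have hX : 0 < x ^ 2 + y ^ 2 := by positivity
  have key := integrableOn_and_abs_integral_le_of_abs_le (γ := α + 3 / 2)
    (B := κ * (x ^ 2 + y ^ 2) / 8) (K := (C * C') * (x * (x * y) ^ (α + 1 / 2)))
    (f := rieszIntegrand α Φ k x y) (by linarith)
    (by positivity) (aestronglyMeasurable_rieszIntegrand hΦ.1 k x y) (fun t ht => by
      set E := Real.exp (-(κ * (x ^ 2 + y ^ 2) / 8 / t))
      have e : t ^ (-(α + 3 / 2) - 1) = t ^ (-(1 / 2) : ℝ) * t ^ (-(α + 1) - 1) := by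
        rw [← Real.rpow_add ht]
        ring_nf
      calc _ ≤ _ := h x y t hx hxy ht
        _ ≤ C * (x * (t ^ (-(1 / 2) : ℝ) * (C' * ((x * y) ^ (α + 1 / 2) *
            (t ^ (-(α + 1) - 1) * E))))) := by
            gcongr
            exact h' x y t hx hy ht hκxy
        _ = _ := by
            rw [e]
            ring)
  refine key.2.trans_eq ?_
  rw [show κ * (x ^ 2 + y ^ 2) / 8 = κ / 8 * (x ^ 2 + y ^ 2) by ring,
    Real.mul_rpow (by positivity) hX.le]
  ring

theorem integrableOn_rieszIntegrand {α ρ : ℝ} (hα : -1 < α) {Φ : ℝ → ℝ} (hρ : ρ ≤ 1)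
    (hΦ : IsSymbol ρ Φ) (k : ℕ) {x y : ℝ} (hx : 0 < x) (hy : 0 < y) (hxy : y ≠ x) :
    IntegrableOn (rieszIntegrand α Φ k x y) (Ioi 0) := by
  have hd : 0 < (x - y) ^ 2 := by
    have : x - y ≠ 0 := sub_ne_zero.2 hxy.symm
    positivity
  -- For mere integrability the constant may depend on the point, so κ is taken as large as x and y
  -- allow.
  obtain ⟨C, -, h⟩ := exists_abs_integral_rieszIntegrand_le (κ := (x - y) ^ 2 / (x ^ 2 + y ^ 2))
    hα (by positivity) hρ hΦ k
  refine (h x y hx hy (le_of_eq ?_)).1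
  field_simp

/-! ### Near the diagonal, large t. -/

/-- Here z ≤ 1, and with y < 2x this gives yσ ≤ 2√σ. Each derivative then costs at most 3√σ, which
√t compensates; no Gaussian decay is needed. -/
theorem rieszIntegrand_le_of_le_sinh {α ρ : ℝ} {Φ : ℝ → ℝ} (hρ : ρ ≤ 1) (hΦ : IsSymbol ρ Φ)
    (k : ℕ) : ∃ C, 0 ≤ C ∧ ∀ x y t : ℝ, 0 < x → 0 < y → y < 2 * x → 0 < t →
      x * y ≤ Real.sinh t → |rieszIntegrand α Φ k x y t| ≤
        C * ((x * y) ^ (α + 1 / 2) * (t⁻¹ * (Real.sinh t)⁻¹ ^ (α + 1))) := by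
  obtain ⟨C, hC, h⟩ := abs_rieszIntegrand_le (α := α) hρ hΦ k
  refine ⟨C * (2 * 3 ^ k), by positivity, fun x y t hx hy hyx ht hs => ?_⟩
  refine (h x y t hx hy ht).trans ?_
  have hs0 : 0 < Real.sinh t := Real.sinh_pos_iff.2 ht
  have hts := sqrt_mul_sqrt_inv_sinh_le_one ht
  have hz : x * y * (Real.sinh t)⁻¹ ≤ 1 := by
    rw [← div_eq_mul_inv]
    exact div_le_one_of_le₀ hs hs0.le
  rw [rieszMajorant, rpow_half_sub_one ht]
  set σ := (Real.sinh t)⁻¹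
  have hσ0 : 0 < σ := inv_pos.2 hs0
  have hσs : √σ ^ 2 = σ := Real.sq_sqrt hσ0.le
  have hsσ : 0 < √σ := Real.sqrt_pos.2 hσ0
  have hb : y * σ ≤ 2 * √σ := by
    refine le_of_sq_le_sq ?_ (by positivity)
    have : y ^ 2 ≤ 2 * (x * y) := by nlinarith
    calc (y * σ) ^ 2 = y ^ 2 * σ * σ := by ring
      _ ≤ 2 * (x * y) * σ * σ := by gcongr
      _ = 2 * (x * y * σ) * σ := by ring
      _ ≤ 2 * 1 * σ := by gcongr
      _ ≤ 4 * σ := by linarith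
      _ = (2 * √σ) ^ 2 := by rw [mul_pow, hσs]; norm_num
  have hexp : Real.exp (-((x - y) ^ 2 / (4 * t))) ≤ 1 :=
    Real.exp_le_one_iff.2 (neg_nonpos.2 (by positivity))
  rw [rpow_half_mul_rpow hx hy hσ0]
  calc _ ≤ C * (√t ^ k * t⁻¹ * ((x * y) ^ (α + 1 / 2) * σ ^ (α + 1)) * ((1 + 1) *
        (2 * √σ + √σ) ^ k * 1)) := by gcongr
    _ = C * (t⁻¹ * ((x * y) ^ (α + 1 / 2) * σ ^ (α + 1)) * (2 *
        3 ^ k * (√t * √σ) ^ k)) := by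
        rw [show 2 * √σ + √σ = 3 * √σ by ring, mul_pow, mul_pow]
        ring
    _ ≤ C * (t⁻¹ * ((x * y) ^ (α + 1 / 2) * σ ^ (α + 1)) * (2 * 3 ^ k * 1 ^ k)) := by gcongr
    _ = _ := by
        rw [one_pow]
        ring

theorem abs_setIntegral_Ioi_rieszIntegrand_le {α ρ : ℝ} (hα : -1 < α) {Φ : ℝ → ℝ} (hρ : ρ ≤ 1)
    (hΦ : IsSymbol ρ Φ) (k : ℕ) : ∃ C, 0 ≤ C ∧ ∀ x y : ℝ, 0 < x → x / 2 < y → y < 2 * x →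
      |∫ t in Ioi (Real.arsinh (x * y)), rieszIntegrand α Φ k x y t| ≤ C * (1 / x) := by
  obtain ⟨C, hC, h⟩ := rieszIntegrand_le_of_le_sinh (α := α) hρ hΦ k
  have hα1 : 0 < α + 1 := by linarith
  refine ⟨C * ((α + 1)⁻¹ * 2), by positivity, fun x y hx hxy hyx => ?_⟩
  have hy : 0 < y := by linarith
  have hp : 0 < x * y := by positivity
  have ht₀ : 0 < Real.arsinh (x * y) := Real.arsinh_pos_iff.2 hp
  obtain ⟨hi, hv⟩ := integrableOn_inv_mul_sinh_rpow (γ := α + 1) hα1 ht₀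
  rw [Real.sinh_arsinh] at hv
  rw [← Real.norm_eq_abs]
  calc _ ≤ ∫ t in Ioi (Real.arsinh (x * y)),
        C * (x * y) ^ (α + 1 / 2) * (t⁻¹ * (Real.sinh t)⁻¹ ^ (α + 1)) := by
        refine norm_integral_le_of_norm_le (hi.const_mul _) ?_
        refine (ae_restrict_iff' measurableSet_Ioi).2 (Eventually.of_forall fun t ht => ?_)
        rw [Real.norm_eq_abs, mul_assoc]
        refine h x y t hx hy hyx (ht₀.trans ht) ?_
        rw [← Real.sinh_arsinh (x * y)]
        exact Real.sinh_le_sinh.2 (le_of_lt ht)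
    _ ≤ C * (x * y) ^ (α + 1 / 2) * ((α + 1)⁻¹ * (x * y) ^ (-(α + 1))) := by
        rw [integral_const_mul]
        gcongr
    _ = C * ((α + 1)⁻¹ * ((x * y) ^ (α + 1 / 2) * (x * y) ^ (-(α + 1)))) := by ring
    _ = C * ((α + 1)⁻¹ * (√(x * y))⁻¹) := by
        rw [← Real.rpow_add hp, show α + 1 / 2 + -(α + 1) = -(1 / 2) by ring,
          Real.rpow_neg hp.le, Real.sqrt_eq_rpow]
    _ ≤ C * ((α + 1)⁻¹ * (2 * (1 / x))) := by
        gcongr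
        rw [inv_eq_one_div, mul_one_div, div_le_div_iff₀ (Real.sqrt_pos.2 hp) hx, one_mul]
        have : x / 2 ≤ √(x * y) := Real.le_sqrt_of_sq_le (by nlinarith)
        linarith
    _ = _ := by ring

/-! ### Near the diagonal, small t: comparison with the Hermite kernel. -/

/-- For the pure Gaussian a derivative costs only √σ; the extra cost b = yσ allowed in the general
bound would be too much for the comparison. -/
theorem mehlerWeight_mul_abs_iteratedDeriv_gaussExp_le (m : ℕ) :
    ∃ C, 0 ≤ C ∧ ∀ x y t : ℝ, 0 < x → 0 < y → 0 < t → mehlerWeight x y t *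
      |iteratedDeriv m (gaussExp (Real.exp (-t) * (Real.sinh t)⁻¹ / 2)
        (y * (Real.sinh t)⁻¹)) x| ≤
      C * √(Real.sinh t)⁻¹ ^ m * Real.exp (-((x - y) ^ 2 / (4 * t))) := by
  obtain ⟨C, hC, h⟩ := abs_iteratedDeriv_gaussExp_le m
  refine ⟨C, hC, fun x y t hx hy ht => ?_⟩
  have hs : 0 < Real.sinh t := Real.sinh_pos_iff.2 ht
  have hw := mehlerWeight_mul_exp_le hx hy ht
  set σ := (Real.sinh t)⁻¹ with hσ
  have hσ0 : 0 < σ := inv_pos.2 hs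
  set a := Real.exp (-t) * σ / 2 with ha
  have haσ : 2 * a ≤ σ := by
    have : Real.exp (-t) ≤ 1 := Real.exp_le_one_iff.2 (by linarith)
    rw [ha]
    nlinarith
  have hM : 0 < mehlerWeight x y t := Real.exp_pos _
  calc _ ≤ mehlerWeight x y t * (C * √(2 * a) ^ m *
        Real.exp (3 / 4 * (y * σ * x - a * x ^ 2) + (y * σ) ^ 2 / (16 * a))) := by
        gcongr
        exact h a (y * σ) x (by positivity)
    _ ≤ mehlerWeight x y t * (C * √σ ^ m *
        Real.exp (3 / 4 * (y * σ * x - a * x ^ 2) + (y * σ) ^ 2 / (16 * a))) := by gcongr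
    _ = C * √σ ^ m * (mehlerWeight x y t *
        Real.exp (3 / 4 * (y * σ * x - a * x ^ 2) + (y * σ) ^ 2 / (16 * a))) := by ring
    _ ≤ _ := by gcongr

/-- The symbol decay is used in full here. At least one derivative makes the total exponent
nonnegative for all α > -1, so the bound persists as z → 0. -/
theorem IsBesselSymbol.abs_rpow_mul_iteratedDeriv_le {α : ℝ} (hα : -1 < α) {Φ : ℝ → ℝ}
    (hΦ : IsBesselSymbol α Φ) (j : ℕ) : ∃ C, 0 ≤ C ∧ ∀ z, 0 < z →
      |z ^ (α + 1 / 2) * (z ^ (j + 1) * iteratedDeriv (j + 1) Φ z)| ≤ C := by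
  obtain ⟨C, hC, h⟩ := hΦ.symbol.2 (j + 1)
  refine ⟨C, hC, fun z hz => ?_⟩
  set p := α + 1 / 2 + ((j + 1 : ℕ) : ℝ) with hp
  have hp0 : 0 ≤ p := by
    have : (0 : ℝ) ≤ j := by positivity
    rw [hp]
    push_cast
    linarith
  have h1 := h z hz.le
  rw [show -(α + 1 / 2) - ((j + 1 : ℕ) : ℝ) = -p by rw [hp]; ring,
    Real.rpow_neg (by linarith), ← div_eq_mul_inv] at h1
  rw [← mul_assoc, ← Real.rpow_natCast, ← Real.rpow_add hz, abs_mul, abs_of_pos (by positivity)]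
  calc _ ≤ (1 + z) ^ p * (C / (1 + z) ^ p) := by
        gcongr
        linarith
    _ = C := by
        have : 0 < (1 + z) ^ p := by positivity
        field_simp

/-- Expand by Leibniz. As (yσ)^(j+1) = (z/x)^(j+1), j+1 derivatives on Φ leave x^(-j-1) times a
bounded quantity, with √t/x ≤ 2 absorbing j of these powers. With no derivative on Φ, the
asymptotics gain 1/z, and √σ/z ≤ 2/x because z ≥ 1 and x < 2y. -/
theorem abs_rieszIntegrand_sub_hermite_le {α : ℝ} (hα : -1 < α) {Φ : ℝ → ℝ}
    (hΦ : IsBesselSymbol α Φ) (k : ℕ) : ∃ C, 0 ≤ C ∧ ∀ x y t : ℝ, 0 < x → x / 2 < y →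
      y < 2 * x → 0 < t → Real.sinh t ≤ x * y →
      |rieszIntegrand α Φ k x y t - 1 / √(2 * Real.pi) *
        rieszIntegrand (-1 / 2) (fun _ => 1) k x y t| ≤
        C * (1 / x * (t⁻¹ * Real.exp (-((x - y) ^ 2 / (4 * t))))) := by
  obtain ⟨A, hA, hAb⟩ := hΦ.asymp
  choose D hD hDb using hΦ.abs_rpow_mul_iteratedDeriv_le hα
  choose H hH hHb using mehlerWeight_mul_abs_iteratedDeriv_gaussExp_le
  refine ⟨(∑ j ∈ Finset.range k, k.choose (j + 1) * D j * H (k - (j + 1)) * 2 ^ j) +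
    A * H k * 2, add_nonneg (Finset.sum_nonneg fun j _ => ?_) ?_, fun x y t hx hxy hyx ht hsz => ?_⟩
  · have := hD j
    have := hH (k - (j + 1))
    positivity
  · have := hH k
    positivity
  have hy : 0 < y := by linarith
  have hs : 0 < Real.sinh t := Real.sinh_pos_iff.2 ht
  have hts := sqrt_mul_sqrt_inv_sinh_le_one ht
  have hH' := fun m => hHb m x y t hx hy ht
  have hM : 0 < mehlerWeight x y t := Real.exp_pos _
  have hz1 : 1 ≤ x * y * (Real.sinh t)⁻¹ := by
    rw [← div_eq_mul_inv]
    exact (one_le_div hs).2 hsz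
  have hcst : besselGauss (fun _ => 1) (Real.exp (-t) * (Real.sinh t)⁻¹ / 2)
      (y * (Real.sinh t)⁻¹) = gaussExp (Real.exp (-t) * (Real.sinh t)⁻¹ / 2)
      (y * (Real.sinh t)⁻¹) := funext fun u => one_mul _
  rw [rieszIntegrand, rieszIntegrand, hcst, show (-1 / 2 + 1 / 2 : ℝ) = 0 by ring,
    Real.rpow_zero, rpow_half_sub_one ht, iteratedDeriv_besselGauss hΦ.symbol.1,
    Finset.sum_range_succ']
  have htx : √t / x ≤ 2 := by
    rw [div_le_iff₀ hx, Real.sqrt_le_left (by positivity)]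
    have := Real.self_le_sinh_iff.2 ht.le
    nlinarith
  set σ := (Real.sinh t)⁻¹
  have hσ0 : 0 < σ := inv_pos.2 hs
  have hsσ : 0 < √σ := Real.sqrt_pos.2 hσ0
  have hσs : √σ ^ 2 = σ := Real.sq_sqrt hσ0.le
  have hτ : 0 < √t := Real.sqrt_pos.2 ht
  rw [← Real.sqrt_eq_rpow]
  set z := x * y * σ with hz
  have hz0 : 0 < z := by positivity
  set P : ℕ → ℝ := fun m => iteratedDeriv m (gaussExp (Real.exp (-t) * σ / 2) (y * σ)) x with hP
  set M := mehlerWeight x y t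
  set Q := Real.exp (-((x - y) ^ 2 / (4 * t))) with hQ
  have hQ0 : 0 < Q := Real.exp_pos _
  have hyz : y * σ * x = z := by rw [hz]; ring
  have hyx' : y * σ = z / x := by rw [hz]; field_simp
  -- the terms in which at least one derivative falls on `Φ`
  have hterm : ∀ j ∈ Finset.range k, |√t ^ k * t⁻¹ * (√σ * z ^ (α + 1 / 2) * M *
      (k.choose (j + 1) * ((y * σ) ^ (j + 1) * iteratedDeriv (j + 1) Φ (y * σ * x)) *
        P (k - (j + 1))))| ≤
      k.choose (j + 1) * D j * H (k - (j + 1)) * 2 ^ j * (1 / x * (t⁻¹ * Q)) := by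
    intro j hj
    have hjk : k = (k - (j + 1)) + (j + 1) := by
      have := Finset.mem_range.1 hj
      omega
    have hDj := hDb j z hz0
    have hD0 := hD j
    have hH0 := hH (k - (j + 1))
    have e : √t ^ k * t⁻¹ * (√σ * z ^ (α + 1 / 2) * M *
        (k.choose (j + 1) * ((y * σ) ^ (j + 1) * iteratedDeriv (j + 1) Φ (y * σ * x)) *
        P (k - (j + 1)))) = k.choose (j + 1) * (√t ^ k * t⁻¹ * √σ * (1 / x) ^ (j + 1)) *
        (z ^ (α + 1 / 2) * (z ^ (j + 1) * iteratedDeriv (j + 1) Φ z)) *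
        (M * P (k - (j + 1))) := by
      rw [hyz, hyx', div_pow, div_pow, one_pow]
      ring
    have e2 : |M * P (k - (j + 1))| = M * |P (k - (j + 1))| := by rw [abs_mul, abs_of_pos hM]
    rw [e, abs_mul, abs_mul, e2, abs_of_nonneg (by positivity)]
    calc _ ≤ k.choose (j + 1) * (√t ^ k * t⁻¹ * √σ * (1 / x) ^ (j + 1)) * D j *
          (H (k - (j + 1)) * √σ ^ (k - (j + 1)) * Q) := by
          refine mul_le_mul ?_ (hH' _) (by positivity) (by positivity)
          gcongr
      _ = k.choose (j + 1) * D j * H (k - (j + 1)) * ((√t * √σ) ^ (k - (j + 1)) *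
          ((√t / x) ^ j * (√t * √σ))) * (1 / x * (t⁻¹ * Q)) := by
          have : √t ^ k = √t ^ (k - (j + 1)) * √t ^ (j + 1) := by rw [← pow_add, ← hjk]
          rw [this, mul_pow, div_pow, div_pow, one_pow, pow_succ √t, pow_succ x]
          field_simp
      _ ≤ k.choose (j + 1) * D j * H (k - (j + 1)) * (1 ^ (k - (j + 1)) *
          (2 ^ j * 1)) * (1 / x * (t⁻¹ * Q)) := by gcongr
      _ = _ := by
          rw [one_pow]
          ring
  -- the term in which all derivatives fall on the Gaussian
  have hlead : |√t ^ k * t⁻¹ * (√σ * M * ((z ^ (α + 1 / 2) * Φ z - 1 / √(2 * Real.pi)) * P k))| ≤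
      A * H k * 2 * (1 / x * (t⁻¹ * Q)) := by
    have hH0 := hH k
    have hsz : √σ / z ≤ 2 * (1 / x) := by
      rw [mul_one_div, div_le_div_iff₀ hz0 hx]
      have h1 : 1 ≤ 2 * (y * √σ) := by
        refine le_of_sq_le_sq ?_ (by positivity)
        have : 1 ≤ 4 * (y ^ 2 * σ) := by
          calc (1 : ℝ) ≤ x * y * σ := hz1
            _ ≤ 4 * y * y * σ := by
              gcongr
              linarith
            _ = _ := by ring
        calc (1 : ℝ) ^ 2 = 1 := one_pow 2
          _ ≤ _ := this
          _ = (2 * (y * √σ)) ^ 2 := by rw [mul_pow, mul_pow, hσs]; ring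
      calc √σ * x = √σ * x * 1 := by ring
        _ ≤ √σ * x * (2 * (y * √σ)) := by gcongr
        _ = 2 * (x * y * √σ ^ 2) := by ring
        _ = 2 * z := by rw [hσs]
    have e : √t ^ k * t⁻¹ * (√σ * M * ((z ^ (α + 1 / 2) * Φ z - 1 / √(2 * Real.pi)) * P k)) =
        √t ^ k * t⁻¹ * √σ * (z ^ (α + 1 / 2) * Φ z - 1 / √(2 * Real.pi)) * (M * P k) := by ring
    have e2 : |M * P k| = M * |P k| := by rw [abs_mul, abs_of_pos hM]
    rw [e, abs_mul, abs_mul, e2, abs_of_nonneg (by positivity)]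
    calc _ ≤ √t ^ k * t⁻¹ * √σ * (A / z) * (H k * √σ ^ k * Q) := by
          refine mul_le_mul ?_ (hH' _) (by positivity) (by positivity)
          gcongr
          exact hAb z hz1
      _ = A * H k * ((√t * √σ) ^ k * (√σ / z)) * (t⁻¹ * Q) := by
          rw [mul_pow]
          ring
      _ ≤ A * H k * (1 ^ k * (2 * (1 / x))) * (t⁻¹ * Q) := by gcongr
      _ = _ := by
          rw [one_pow]
          ring
  have hsplit : √t ^ k * t⁻¹ * (√σ * z ^ (α + 1 / 2) * M *
      ((∑ j ∈ Finset.range k, k.choose (j + 1) *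
        ((y * σ) ^ (j + 1) * iteratedDeriv (j + 1) Φ (y * σ * x)) * P (k - (j + 1))) +
        k.choose 0 * ((y * σ) ^ 0 * iteratedDeriv 0 Φ (y * σ * x)) * P (k - 0))) -
      1 / √(2 * Real.pi) * (√t ^ k * t⁻¹ * (√σ * 1 * M * P k)) =
      (∑ j ∈ Finset.range k, √t ^ k * t⁻¹ * (√σ * z ^ (α + 1 / 2) * M *
        (k.choose (j + 1) * ((y * σ) ^ (j + 1) * iteratedDeriv (j + 1) Φ (y * σ * x)) *
        P (k - (j + 1))))) +
      √t ^ k * t⁻¹ * (√σ * M * ((z ^ (α + 1 / 2) * Φ z - 1 / √(2 * Real.pi)) * P k)) := by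
    rw [← Finset.mul_sum, ← Finset.mul_sum, Nat.choose_zero_right, pow_zero, iteratedDeriv_zero,
      hyz, Nat.sub_zero]
    push_cast
    ring
  rw [hsplit, add_mul, Finset.sum_mul]
  exact (abs_add_le _ _).trans (add_le_add
    ((Finset.abs_sum_le_sum_abs _ _).trans (Finset.sum_le_sum hterm)) hlead)

/-- The Gaussian is spent as e^(-u) ≤ u^(-1/4): this makes t⁻¹ integrable at 0 and produces exactly
the power |x-y|^(-1/2) of (iii). -/
theorem inv_mul_exp_neg_le {d t : ℝ} (hd : 0 < d) (ht : 0 < t) :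
    t⁻¹ * Real.exp (-(d ^ 2 / (4 * t))) ≤ 2 * (d ^ (-(1 / 2) : ℝ) * t ^ (-(3 / 4) : ℝ)) := by
  set u := d ^ 2 / (4 * t) with hu
  have hu0 : 0 < u := by positivity
  have h1 : u ^ (1 / 4 : ℝ) ≤ Real.exp u := by
    have h2 : u ^ (1 / 4 : ℝ) ≤ (1 + u) ^ (1 : ℝ) :=
      (Real.rpow_le_rpow hu0.le (by linarith) (by norm_num)).trans
        (Real.rpow_le_rpow_of_exponent_le (by linarith) (by norm_num))
    rw [Real.rpow_one] at h2
    linarith [Real.add_one_le_exp u]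
  have h3 : Real.exp (-u) ≤ u ^ (-(1 / 4) : ℝ) := by
    rw [Real.exp_neg, Real.rpow_neg hu0.le]
    exact inv_anti₀ (by positivity) h1
  have h4 : u ^ (-(1 / 4) : ℝ) = 4 ^ (1 / 4 : ℝ) * d ^ (-(1 / 2) : ℝ) * t ^ (1 / 4 : ℝ) := by
    rw [hu, Real.div_rpow (by positivity) (by positivity), Real.mul_rpow (by norm_num) ht.le,
      ← Real.rpow_natCast d 2, ← Real.rpow_mul hd.le, Real.rpow_neg (by norm_num : (0 : ℝ) ≤ 4),
      Real.rpow_neg ht.le]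
    norm_num
    field_simp
  have h5 : (4 : ℝ) ^ (1 / 4 : ℝ) ≤ 2 := by
    calc (4 : ℝ) ^ (1 / 4 : ℝ) ≤ 4 ^ (1 / 2 : ℝ) :=
          Real.rpow_le_rpow_of_exponent_le (by norm_num) (by norm_num)
      _ = 2 := by
        rw [← Real.sqrt_eq_rpow, show (4 : ℝ) = 2 ^ 2 by norm_num, Real.sqrt_sq (by norm_num)]
  calc t⁻¹ * Real.exp (-u) ≤ t⁻¹ * (2 * d ^ (-(1 / 2) : ℝ) * t ^ (1 / 4 : ℝ)) := by
        refine mul_le_mul_of_nonneg_left (h3.trans ?_) (by positivity)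
        rw [h4]
        gcongr
    _ = 2 * (d ^ (-(1 / 2) : ℝ) * (t ^ (1 / 4 : ℝ) / t)) := by ring
    _ = _ := by
        rw [← Real.rpow_sub_one ht.ne']
        norm_num

theorem exists_abs_integral_sub_hermite_le {α : ℝ} (hα : -1 < α) {Φ : ℝ → ℝ}
    (hΦ : IsBesselSymbol α Φ) (k : ℕ) : ∃ C, 0 ≤ C ∧ ∀ x y : ℝ, 0 < x → x / 2 < y →
      y < 2 * x → y ≠ x →
      |(∫ t in Ioi (0 : ℝ), rieszIntegrand α Φ k x y t) - 1 / √(2 * Real.pi) *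
        ∫ t in Ioi (0 : ℝ), rieszIntegrand (-1 / 2) (fun _ => 1) k x y t| ≤
        C * (1 / x) * (1 + (x / |x - y|) ^ (1 / 2 : ℝ)) := by
  have hρ : -(α + 1 / 2) ≤ 1 := by linarith
  obtain ⟨C₀, hC₀, h₀⟩ := abs_rieszIntegrand_sub_hermite_le hα hΦ k
  obtain ⟨C₁, hC₁, h₁⟩ := abs_setIntegral_Ioi_rieszIntegrand_le hα hρ hΦ.symbol k
  obtain ⟨C₂, hC₂, h₂⟩ := abs_setIntegral_Ioi_rieszIntegrand_le (α := -1 / 2) (by norm_num)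
    zero_le_one isSymbol_one k
  set c := 1 / √(2 * Real.pi) with hc
  have hc0 : 0 ≤ c := by positivity
  refine ⟨16 * C₀ + C₁ + c * C₂, by positivity, fun x y hx hxy hyx hne => ?_⟩
  have hy : 0 < y := by linarith
  have hp : 0 < x * y := by positivity
  have hd : 0 < |x - y| := abs_pos.2 (sub_ne_zero.2 hne.symm)
  have hI := integrableOn_rieszIntegrand hα hρ hΦ.symbol k hx hy hne
  have hJ := integrableOn_rieszIntegrand (α := -1 / 2) (by norm_num) zero_le_one isSymbol_one k
    hx hy hne
  -- The cut is where z = xy/sinh t equals 1.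
  set t₀ := Real.arsinh (x * y) with ht₀
  have ht₀0 : 0 < t₀ := Real.arsinh_pos_iff.2 hp
  have ht₀x : t₀ ≤ x * y := by
    rw [← Real.sinh_arsinh (x * y), ← ht₀]
    exact Real.self_le_sinh_iff.2 ht₀0.le
  set f := rieszIntegrand α Φ k x y
  set g := rieszIntegrand (-1 / 2) (fun _ => 1) k x y
  have hsub : ∀ h : ℝ → ℝ, IntegrableOn h (Ioi 0) →
      ∫ t in Ioi (0 : ℝ), h t = (∫ t in Ioc 0 t₀, h t) + ∫ t in Ioi t₀, h t := by
    intro h hh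
    rw [← Ioc_union_Ioi_eq_Ioi ht₀0.le, setIntegral_union Ioc_disjoint_Ioi_same
      measurableSet_Ioi (hh.mono_set fun t ht => ht.1)
      (hh.mono_set (Ioi_subset_Ioi ht₀0.le))]
  have hnear : |∫ t in Ioc 0 t₀, (f t - c * g t)| ≤
      16 * C₀ * (1 / x) * (x / |x - y|) ^ (1 / 2 : ℝ) := by
    have hint : IntervalIntegrable (fun t : ℝ => t ^ (-(3 / 4) : ℝ)) volume 0 t₀ :=
      intervalIntegral.intervalIntegrable_rpow' (by norm_num)
    rw [intervalIntegrable_iff_integrableOn_Ioc_of_le ht₀0.le] at hint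
    rw [← Real.norm_eq_abs]
    calc _ ≤ ∫ t in Ioc 0 t₀, C₀ * (1 / x) * 2 * |x - y| ^ (-(1 / 2) : ℝ) *
          t ^ (-(3 / 4) : ℝ) := by
          refine norm_integral_le_of_norm_le (hint.const_mul _) ?_
          refine (ae_restrict_iff' measurableSet_Ioc).2 (Eventually.of_forall fun t ht => ?_)
          have hts : Real.sinh t ≤ x * y := by
            rw [← Real.sinh_arsinh (x * y)]
            exact Real.sinh_le_sinh.2 ht.2
          rw [Real.norm_eq_abs]
          refine (h₀ x y t hx hxy hyx ht.1 hts).trans ?_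
          have := inv_mul_exp_neg_le hd ht.1
          rw [sq_abs] at this
          calc _ ≤ C₀ * (1 / x * (2 * (|x - y| ^ (-(1 / 2) : ℝ) * t ^ (-(3 / 4) : ℝ)))) := by
                gcongr
            _ = _ := by ring
      _ = C₀ * (1 / x) * 2 * |x - y| ^ (-(1 / 2) : ℝ) * (4 * t₀ ^ (1 / 4 : ℝ)) := by
          rw [integral_const_mul, ← intervalIntegral.integral_of_le ht₀0.le,
            integral_rpow (Or.inl (by norm_num))]
          norm_num
          left
          ring
      _ ≤ C₀ * (1 / x) * 2 * |x - y| ^ (-(1 / 2) : ℝ) * (4 * (2 * x ^ (1 / 2 : ℝ))) := by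
          gcongr
          -- t₀ ≤ xy ≤ 2x² ≤ (2x)², so the upper limit contributes a multiple of x^(1/2).
          calc t₀ ^ (1 / 4 : ℝ) ≤ ((2 * x) ^ 2) ^ (1 / 4 : ℝ) := by
                gcongr
                nlinarith
            _ = (2 * x) ^ (1 / 2 : ℝ) := by
                rw [← Real.rpow_natCast (2 * x) 2, ← Real.rpow_mul (by positivity)]
                norm_num
            _ = 2 ^ (1 / 2 : ℝ) * x ^ (1 / 2 : ℝ) := Real.mul_rpow (by norm_num) hx.le
            _ ≤ 2 ^ (1 : ℝ) * x ^ (1 / 2 : ℝ) := by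
                gcongr
                · norm_num
                · norm_num
            _ = _ := by rw [Real.rpow_one]
      _ = _ := by
          rw [Real.div_rpow hx.le hd.le, Real.rpow_neg hd.le]
          ring
  have hnear' : ∫ t in Ioc 0 t₀, (f t - c * g t) =
      (∫ t in Ioc 0 t₀, f t) - c * ∫ t in Ioc 0 t₀, g t := by
    rw [integral_sub (hI.mono_set fun t ht => ht.1) ((hJ.mono_set fun t ht => ht.1).const_mul c),
      integral_const_mul]
  rw [hsub f hI, hsub g hJ]
  have h₁' := h₁ x y hx hxy hyx
  have h₂' := h₂ x y hx hxy hyx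
  set r := (x / |x - y|) ^ (1 / 2 : ℝ) with hr
  have hr0 : 0 ≤ r := by positivity
  have e : (∫ t in Ioc 0 t₀, f t) + (∫ t in Ioi t₀, f t) -
      c * ((∫ t in Ioc 0 t₀, g t) + ∫ t in Ioi t₀, g t) =
      (∫ t in Ioc 0 t₀, (f t - c * g t)) + (∫ t in Ioi t₀, f t) - c * ∫ t in Ioi t₀, g t := by
    rw [hnear']
    ring
  rw [e]
  calc _ ≤ |∫ t in Ioc 0 t₀, (f t - c * g t)| + |∫ t in Ioi t₀, f t| +
        |c * ∫ t in Ioi t₀, g t| :=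
        (abs_sub _ _).trans (add_le_add_left (abs_add_le _ _) _)
    _ ≤ 16 * C₀ * (1 / x) * r + C₁ * (1 / x) + c * (C₂ * (1 / x)) := by
        rw [abs_mul, abs_of_nonneg hc0]
        gcongr
    _ ≤ 16 * C₀ * (1 / x) * (1 + r) + C₁ * (1 / x) * (1 + r) + c * (C₂ * (1 / x)) * (1 + r) := by
        have a1 : 0 ≤ 16 * C₀ * (1 / x) := by positivity
        have a2 : 0 ≤ C₁ * (1 / x) * r := by positivity
        have a3 : 0 ≤ c * (C₂ * (1 / x)) * r := by positivity
        nlinarith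
    _ = _ := by ring

/-! ### Assembly of the estimates. -/

theorem proposition3p3 (α : ℝ) (hα : -1 < α) (k : ℕ) (hk : 1 ≤ k) :
    (∀ x y : ℝ, 0 < x → 0 < y → y ≠ x →
      MeasureTheory.IntegrableOn (laguerreRieszIntegrand α k x y) (Set.Ioi 0) ∧
      MeasureTheory.IntegrableOn (hermiteRieszIntegrand k x y) (Set.Ioi 0)) ∧
    ∃ C : ℝ, 0 < C ∧
      (∀ x y : ℝ, 0 < y → y < x / 2 →
        |laguerreRieszKernel α k x y| ≤ C * (y ^ (α + 1 / 2) / x ^ (α + 3 / 2))) ∧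
      (Even k → ∀ x y : ℝ, 0 < x → 2 * x < y →
        |laguerreRieszKernel α k x y| ≤ C * (x ^ (α + 1 / 2) / y ^ (α + 3 / 2))) ∧
      (Odd k → ∀ x y : ℝ, 0 < x → 2 * x < y →
        |laguerreRieszKernel α k x y| ≤ C * (x ^ (α + 3 / 2) / y ^ (α + 5 / 2))) ∧
      (∀ x y : ℝ, 0 < x → x / 2 < y → y < 2 * x → y ≠ x →
        |laguerreRieszKernel α k x y - hermiteRieszKernel k x y| ≤
          C * (1 / x) * (1 + (x / |x - y|) ^ (1 / 2 : ℝ))) := by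
  obtain ⟨Φ, hΦ⟩ := exists_isBesselSymbol hα
  have hρ : -(α + 1 / 2) ≤ 1 := by linarith
  have hL : ∀ x y, 0 < x → 0 < y →
      EqOn (laguerreRieszIntegrand α k x y) (rieszIntegrand α Φ k x y) (Ioi 0) :=
    fun x y hx hy t ht => laguerreRieszIntegrand_eq hΦ k hx hy ht
  have hH : ∀ x y, EqOn (hermiteRieszIntegrand k x y)
      (fun t => 1 / √(2 * Real.pi) * rieszIntegrand (-1 / 2) (fun _ => 1) k x y t) (Ioi 0) :=
    fun x y t ht => hermiteRieszIntegrand_eq_rieszIntegrand k ht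
  have hG : 0 < Real.Gamma ((k : ℝ) / 2) := Real.Gamma_pos_of_pos (by positivity)
  set G := 1 / Real.Gamma ((k : ℝ) / 2) with hGdef
  have hG0 : 0 < G := by positivity
  have hKL : ∀ x y, 0 < x → 0 < y → laguerreRieszKernel α k x y =
      G * ∫ t in Ioi (0 : ℝ), rieszIntegrand α Φ k x y t := fun x y hx hy => by
    rw [laguerreRieszKernel, setIntegral_congr_fun measurableSet_Ioi (hL x y hx hy)]
  have hKH : ∀ x y, hermiteRieszKernel k x y = G * (1 / √(2 * Real.pi) *
      ∫ t in Ioi (0 : ℝ), rieszIntegrand (-1 / 2) (fun _ => 1) k x y t) := fun x y => by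
    rw [hermiteRieszKernel, setIntegral_congr_fun measurableSet_Ioi (hH x y), integral_const_mul]
  refine ⟨fun x y hx hy hne => ⟨?_, ?_⟩, ?_⟩
  · exact (integrableOn_rieszIntegrand hα hρ hΦ.symbol k hx hy hne).congr_fun
      (hL x y hx hy).symm measurableSet_Ioi
  · exact IntegrableOn.congr_fun ((integrableOn_rieszIntegrand (α := -1 / 2) (by norm_num)
      zero_le_one isSymbol_one k hx hy hne).const_mul _) (hH x y).symm measurableSet_Ioi
  -- 1/5 is the value of (x-y)²/(x²+y²) when one variable is twice the other, hence the best κ for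
  -- both off-diagonal regions.
  obtain ⟨C₁, hC₁, h₁⟩ := exists_abs_integral_rieszIntegrand_le (κ := 1 / 5) hα (by norm_num)
    hρ hΦ.symbol k
  obtain ⟨C₂, hC₂, h₂⟩ := exists_abs_integral_sub_hermite_le hα hΦ k
  obtain ⟨C₃, hC₃, h₃⟩ : ∃ C, 0 ≤ C ∧ (Odd k → ∀ x y : ℝ, 0 < x → x ≤ y →
      1 / 5 * (x ^ 2 + y ^ 2) ≤ (x - y) ^ 2 →
      |∫ t in Ioi (0 : ℝ), rieszIntegrand α Φ k x y t| ≤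
        C * (x * (x * y) ^ (α + 1 / 2) * (x ^ 2 + y ^ 2) ^ (-(α + 3 / 2)))) := by
    by_cases hodd : Odd k
    · obtain ⟨C, hC, h⟩ := exists_abs_integral_rieszIntegrand_le_of_odd (κ := 1 / 5) hα
        (by norm_num) hρ hΦ.symbol hΦ.even hodd
      exact ⟨C, hC, fun _ => h⟩
    · exact ⟨0, le_rfl, fun h => absurd h hodd⟩
  -- Used to bound x²+y² below by the square of the larger variable.
  have hsq : ∀ {u v γ : ℝ}, 0 < v → 0 ≤ γ → v ^ 2 ≤ u → u ^ (-γ) ≤ (v ^ (2 * γ))⁻¹ := by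
    intro u v γ hv hγ huv
    have hv2 : 0 < v ^ 2 := by positivity
    rw [Real.rpow_mul hv.le, Real.rpow_two, Real.rpow_neg (hv2.le.trans huv)]
    gcongr
  have hCG : ∀ {c A B : ℝ}, 0 ≤ c → c ≤ C₁ + C₂ + C₃ + 1 → 0 ≤ B → |A| ≤ c * B →
      |G * A| ≤ G * (C₁ + C₂ + C₃ + 1) * B := by
    intro c A B hc hcC hB hA
    rw [abs_mul, abs_of_pos hG0, mul_assoc]
    gcongr
    exact hA.trans (by gcongr)
  refine ⟨G * (C₁ + C₂ + C₃ + 1), by positivity, ?_, ?_, ?_, ?_⟩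
  · intro x y hy hyx
    have hx : 0 < x := by linarith
    rw [hKL x y hx hy]
    refine hCG hC₁ (by linarith) (by positivity) ?_
    refine (h₁ x y hx hy (by nlinarith)).2.trans ?_
    gcongr
    calc _ ≤ (x * y) ^ (α + 1 / 2) * (x ^ (2 * (α + 1)))⁻¹ := by
          gcongr
          exact hsq hx (by linarith) (by nlinarith)
      _ = _ := by
          rw [show 2 * (α + 1) = α + 1 / 2 + (α + 3 / 2) by ring, Real.rpow_add hx,
            Real.mul_rpow hx.le hy.le]
          field_simp
  · intro _ x y hx hxy
    have hy : 0 < y := by linarith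
    rw [hKL x y hx hy]
    refine hCG hC₁ (by linarith) (by positivity) ?_
    refine (h₁ x y hx hy (by nlinarith)).2.trans ?_
    gcongr
    calc _ ≤ (x * y) ^ (α + 1 / 2) * (y ^ (2 * (α + 1)))⁻¹ := by
          gcongr
          exact hsq hy (by linarith) (by nlinarith)
      _ = _ := by
          rw [show 2 * (α + 1) = α + 1 / 2 + (α + 3 / 2) by ring, Real.rpow_add hy,
            Real.mul_rpow hx.le hy.le]
          field_simp
  · intro hodd x y hx hxy
    have hy : 0 < y := by linarith
    rw [hKL x y hx hy]
    refine hCG hC₃ (by linarith) (by positivity) ?_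
    refine (h₃ hodd x y hx (by linarith) (by nlinarith)).trans ?_
    gcongr
    calc _ ≤ x * (x * y) ^ (α + 1 / 2) * (y ^ (2 * (α + 3 / 2)))⁻¹ := by
          gcongr
          exact hsq hy (by linarith) (by nlinarith)
      _ = _ := by
          rw [show 2 * (α + 3 / 2) = α + 1 / 2 + (α + 5 / 2) by ring, Real.rpow_add hy,
            Real.mul_rpow hx.le hy.le, show α + 3 / 2 = α + 1 / 2 + 1 by ring,
            Real.rpow_add_one hx.ne']
          field_simp
  · intro x y hx hxy hyx hne
    rw [hKL x y hx (by linarith), hKH, ← mul_sub, mul_assoc _ (1 / x)]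
    refine hCG hC₂ (by linarith) (by positivity) ?_
    rw [← mul_assoc]
    exact h₂ x y hx hxy hyx hne
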